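/- Let $N\ge 2$ and $m=N-1$. Consider differential polynomials over $\mathbb C$ in a $\mathbb C^{m}$-valued variable $\vec v(x)$ (a row vector) and its conjugate $\bar{\vec v}$, that is, polynomials in $\vec v,\vec v_x,\vec v_{2x},\dots$ and their conjugates, with total derivative $D_x$. Let $\delta/\delta\bar{\vec v}$ be the variational derivative, with components $\sum_n(-D_x)^n\,\partial/\partial(\bar v_j)_{nx}$. Put $\vec A\cdot^\dagger\vec B=\tfrac12\vec A\cdot\vec B+\tfrac12\bar{\vec B}\cdot\bar{\vec A}$, $\vec A\otimes\vec B=\vec A^{T}\vec B$ and $\vec A\wedge^\dagger\vec B=\vec A\otimes\vec B-\bar{\vec B}\otimes\bar{\vec A}$, let $\vec A\lrcorner M$ be the product of a row vector with a matrix, and let $$\mathcal H=D_x-2\mathrm i\,D_x^{-1}(\bar{\vec v}\cdot^\dagger\mathrm i\,\cdot\,)\,\vec v+\vec v\lrcorner D_x^{-1}(\bar{\vec v}\wedge^\dagger\,\cdot\,),\qquad \mathcal I=\mathrm i,\qquad \mathcal R=\mathcal H\circ\mathcal I .$$ Here $D_x^{-1}f$ denotes a differential polynomial whose $D_x$-derivative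 is $f$, with zero constant term unless integration constants are mentioned. The admissible integration constants are: an anti-Hermitian matrix $C$ for the matrix term, and the constant of the scalar term $-2\mathrm i D_x^{-1}(\bar{\vec v}\cdot^\dagger\mathrm i\vec\omega)$ equal to $\operatorname{tr}C$ (so that this term is the trace of $D_x^{-1}(\bar{\vec v}\wedge^\dagger\vec\omega)$). Then $\mathcal H,\mathcal I$ form a Hamiltonian pair: each of them, and each real linear combination, is skew-adjoint and has vanishing Schouten bracket with itself, modulo total derivatives, with respect to the pairing $\bar{\vec\omega}\cdot\vec X+\vec\omega\cdot\bar{\vec X}$, on all covectors for which the inverse derivatives exist as differential polynomials and for all admissible integration constants. Moreover, the recursion $\mathrm i\vec h^{(0)}=\mathrm i\vec v$, $\mathrm i\vec h^{(k+1)}=\mathcal R(\mathrm i\vec h^{(k)})$ is well defined for all $k\ge 0$ (all the inverse derivatives exist), and it determines a unique sequence of vectors $\vec h^{(k)}$ of differential polynomials. The evolutionary vector fields $\mathrm i\vec h^{(k)}$ commute with each other. There are real differential polynomials $H^{(k)}$, $k\ge0$, with $H^{(0)}=-|\vec v|^2$, $H^{(1)}=\tfrac{\mathrm i}{2}(\vec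 v\cdot\bar{\vec v}_x-\vec v_x\cdot\bar{\vec v})$ and $\delta H^{(k)}/\delta\bar{\vec v}=-\vec h^{(k)}$ for all $k\ge 0$, such that for every real constant $\chi$ the following holds. Put $H^{(j,\chi)}=H^{(j)}-\chi H^{(j-2)}$ for $j\ge1$, with $H^{(-1)}=0$. 1. For $k=0,1,2,\dots$ the evolution equations $$\vec v_t=\mathrm i\big(\vec h^{(k+2)}-\chi\vec h^{(k)}\big)=\mathcal H\big(\delta H^{(k+1,\chi)}/\delta\bar{\vec v}\big)=-\mathcal I\big(\delta H^{(k+2,\chi)}/\delta\bar{\vec v}\big)$$ are bi-Hamiltonian, that is, these equalities hold. In the middle expression the integration constants are zero for $k\ge1$; for $k=0$ they are given by $C=-\tfrac{\mathrm i\chi}{N}\mathbf 1$, which contributes the term $-\chi\mathrm i\vec v$. 2. These flows commute with each other. 3. Each of them is invariant under $\vec v\mapsto\vec vA$ for all $A\in U(N-1)$. 4. The flow $k=0$ is the vector NLS equation $\mathrm i\vec v_t=\vec v_{2x}+2|\vec v|^2\vec v+\chi\vec v$, and the flow $k=1$ is the complex vector mKdV equation $\vec v_t=\vec v_{3x}+3|\vec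 v|^2\vec v_x+3(\vec v_x\cdot\bar{\vec v})\vec v+\chi\vec v_x$. -/

import Mathlib

open Matrix

noncomputable section

namespace VectorNLS

/-- Jet coordinates of a `ℂ^m`-valued function `v(x)`: `(false, j, n)` is the `n`-th `x`-derivative
of the component `v_j`, and `(true, j, n)` is the `n`-th `x`-derivative of its conjugate. -/
abbrev JetVar (m : ℕ) : Type := Bool × Fin m × ℕ

/-- Differential polynomials with complex coefficients in `v` and its complex conjugate. -/
abbrev DiffPoly (m : ℕ) : Type := MvPolynomial (JetVar m) ℂ

/-- Row vectors of differential polynomials. -/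
abbrev DVec (m : ℕ) : Type := Fin m → DiffPoly m

/-- The vector `∂_x^n v`. -/
def dv {m : ℕ} (n : ℕ) : DVec m := fun j => MvPolynomial.X (false, j, n)

/-- The vector `∂_x^n v̄`. -/
def dvbar {m : ℕ} (n : ℕ) : DVec m := fun j => MvPolynomial.X (true, j, n)

/-- Complex conjugation of differential polynomials. -/
def conj {m : ℕ} : DiffPoly m →+* DiffPoly m :=
  MvPolynomial.eval₂Hom (MvPolynomial.C.comp (starRingEnd ℂ))
    (fun p => MvPolynomial.X (!p.1, p.2.1, p.2.2))

/-- Complex conjugation of vectors. -/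
def vconj {m : ℕ} (A : DVec m) : DVec m := fun j => conj (A j)

/-- The total derivative `D_x`. -/
def Dx {m : ℕ} : Derivation ℂ (DiffPoly m) (DiffPoly m) :=
  MvPolynomial.mkDerivation ℂ (fun p => MvPolynomial.X (p.1, p.2.1, p.2.2 + 1))

/-- `D_x` applied to the components of a vector. -/
def vDx {m : ℕ} (A : DVec m) : DVec m := fun j => Dx (A j)

/-- `g = D_x⁻¹ f`, where `c` is the constant of integration (the constant term of `g`).
For given `f` and `c` there is at most one such `g`; `c = 0` is the normalized choice. -/
def IsDxInv {m : ℕ} (c : ℂ) (f g : DiffPoly m) : Prop :=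
  Dx g = f ∧ MvPolynomial.constantCoeff g = c

/-- Total `x`-derivatives, i.e. the densities with vanishing functional. -/
def IsTotalDeriv {m : ℕ} (f : DiffPoly m) : Prop := ∃ g, Dx g = f

/-- The Hermitian dot product `A ·† B = (A·B + B̄·Ā)/2`. -/
def hdot {m : ℕ} (A B : DVec m) : DiffPoly m :=
  (1 / 2 : ℂ) • (A ⬝ᵥ B) + (1 / 2 : ℂ) • (vconj B ⬝ᵥ vconj A)

/-- The Hermitian wedge product `A ∧† B = A ⊗ B - B̄ ⊗ Ā`. -/
def hwedge {m : ℕ} (A B : DVec m) : Matrix (Fin m) (Fin m) (DiffPoly m) :=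
  vecMulVec A B - vecMulVec (vconj B) (vconj A)

/-- `X = 𝓗(ω)` for the nonlocal operator
`𝓗 = D_x - 2i D_x⁻¹(v̄ ·† i ) v + v ⌟ D_x⁻¹(v̄ ∧† )`.
The relation says in particular that both inverse derivatives exist as differential polynomials.
The anti-Hermitian matrix `C` holds the integration constants of the matrix `D_x⁻¹(v̄ ∧† ω)`.
The scalar term `-2i D_x⁻¹(v̄ ·† iω)` is a `D_x`-antiderivative of the trace of `v̄ ∧† ω`, and its
constant is fixed so that it equals the trace of that matrix. -/
def HValue {m : ℕ} (C : Matrix (Fin m) (Fin m) ℂ) (ω X : DVec m) : Prop :=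
  ∃ (s : DiffPoly m) (Θ : Matrix (Fin m) (Fin m) (DiffPoly m)),
    IsDxInv ((Complex.I / 2) * C.trace) (hdot (dvbar 0) (Complex.I • ω)) s ∧
    (∀ a b, IsDxInv (C a b) (hwedge (dvbar 0) ω a b) (Θ a b)) ∧
    X = vDx ω - (2 * Complex.I) • (s • dv 0) + dv 0 ᵥ* Θ

/-- The graph of `𝓗`, with all admissible integration constants. -/
def HGraph {m : ℕ} (ω X : DVec m) : Prop :=
  ∃ C : Matrix (Fin m) (Fin m) ℂ, Cᴴ = -C ∧ HValue C ω X

/-- The graph of the operator `𝓘 = i`. -/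
def IGraph {m : ℕ} (ω X : DVec m) : Prop := X = Complex.I • ω

/-- `Y = 𝓡(X)` for the recursion operator `𝓡 = 𝓗 ∘ 𝓘`, with integration constants zero. -/
def RValue {m : ℕ} (X Y : DVec m) : Prop := HValue 0 (Complex.I • X) Y

/-- The evolutionary (prolonged) derivation of the equation `v_t = X`: it commutes with `D_x` and
sends `v` to `X` and `v̄` to `X̄`. -/
def evol {m : ℕ} (X : DVec m) : Derivation ℂ (DiffPoly m) (DiffPoly m) :=
  MvPolynomial.mkDerivation ℂ (fun p => Dx^[p.2.2] (if p.1 then conj (X p.2.1) else X p.2.1))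

/-- `evol X` applied to the components of a vector. -/
def vevol {m : ℕ} (X Y : DVec m) : DVec m := fun j => evol X (Y j)

/-- The flows `v_t = X` and `v_t = Y` commute. -/
def FlowsCommute {m : ℕ} (X Y : DVec m) : Prop := vevol X Y = vevol Y X

/-- The variational derivative `δH/δv̄ = ∑ₙ (-D_x)^n ∂H/∂v̄_{nx}`
(a finite sum, see `varDeriv_support_finite`). -/
def varDeriv {m : ℕ} (H : DiffPoly m) : DVec m := fun j =>
  ∑ᶠ n : ℕ, (-1 : ℂ) ^ n • Dx^[n] (MvPolynomial.pderiv (true, j, n) H)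

lemma varDeriv_support_finite {m : ℕ} (H : DiffPoly m) (j : Fin m) :
    (Function.support fun n : ℕ =>
      (-1 : ℂ) ^ n • Dx^[n] (MvPolynomial.pderiv (true, j, n) H)).Finite := by
  have h0 : ∀ n : ℕ, Dx^[n] (0 : DiffPoly m) = 0 := by
    intro n
    induction n with
    | zero => rfl
    | succ n ih => rw [Function.iterate_succ_apply, map_zero, ih]
  refine (H.vars.image fun p => p.2.2).finite_toSet.subset ?_
  intro n hn
  by_contra hmem
  apply hn
  have hv : ((true, j, n) : JetVar m) ∉ H.vars := fun h =>
    hmem (Finset.mem_coe.2 (Finset.mem_image.2 ⟨_, h, rfl⟩))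
  simp only [MvPolynomial.pderiv_eq_zero_of_notMem_vars hv, h0, smul_zero]

/-- The real pairing `ω̄·X + ω·X̄` of a covector field `ω` and a vector field `X`. -/
def pairing {m : ℕ} (ω X : DVec m) : DiffPoly m := vconj ω ⬝ᵥ X + ω ⬝ᵥ vconj X

/-- The density `⟨L_{X₁} ω₂, X₃⟩` (Lie derivative along `X₁` of the covector field `ω₂`, paired with
`X₃`), up to total derivatives. -/
def lieTerm {m : ℕ} (X₁ ω₂ X₃ : DVec m) : DiffPoly m :=
  pairing (vevol X₁ ω₂) X₃ + pairing ω₂ (vevol X₃ X₁)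

/-- A (possibly nonlocal) operator, given by its graph of pairs `(ω, X)`, is Hamiltonian
(cosymplectic): it is skew-adjoint, and its Schouten bracket with itself vanishes
(equivalently, the Jacobi identity holds), both modulo total derivatives. -/
def IsHamiltonianOp {m : ℕ} (L : DVec m → DVec m → Prop) : Prop :=
  (∀ ω₁ X₁ ω₂ X₂, L ω₁ X₁ → L ω₂ X₂ → IsTotalDeriv (pairing ω₁ X₂ + pairing ω₂ X₁)) ∧
  (∀ ω₁ X₁ ω₂ X₂ ω₃ X₃, L ω₁ X₁ → L ω₂ X₂ → L ω₃ X₃ →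
    IsTotalDeriv (lieTerm X₁ ω₂ X₃ + lieTerm X₂ ω₃ X₁ + lieTerm X₃ ω₁ X₂))

/-- Two operators, given by their graphs, form a Hamiltonian pair: each one and every real linear
combination of them is a Hamiltonian operator. -/
def IsHamiltonianPair {m : ℕ} (L₁ L₂ : DVec m → DVec m → Prop) : Prop :=
  IsHamiltonianOp L₁ ∧ IsHamiltonianOp L₂ ∧
  ∀ a b : ℝ, IsHamiltonianOp fun ω X =>
    ∃ X₁ X₂, L₁ ω X₁ ∧ L₂ ω X₂ ∧ X = (a : ℂ) • X₁ + (b : ℂ) • X₂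

/-- The right action `v ↦ v A` of a constant matrix on vectors of differential polynomials. -/
def actRight {m : ℕ} (A : Matrix (Fin m) (Fin m) ℂ) (w : DVec m) : DVec m :=
  w ᵥ* A.map (fun c => (MvPolynomial.C c : DiffPoly m))

/-- The substitution `v ↦ v A` (and `v̄ ↦ v̄ Ā`) in differential polynomials. -/
def unitarySubst {m : ℕ} (A : Matrix (Fin m) (Fin m) ℂ) : DiffPoly m →ₐ[ℂ] DiffPoly m :=
  MvPolynomial.aeval fun p =>
    if p.1 then actRight (A.map star) (dvbar p.2.2) p.2.1 else actRight A (dv p.2.2) p.2.1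

/-- The evolution equation `v_t = X` is invariant under the unitary group acting on `v`. -/
def IsUnitaryInvariant {m : ℕ} (X : DVec m) : Prop :=
  ∀ A ∈ Matrix.unitaryGroup (Fin m) ℂ, (fun j => unitarySubst A (X j)) = actRight A X

/-- `h` is the hierarchy generated by the recursion operator from the phase rotation:
`i h⁽⁰⁾ = i v` and `i h⁽ᵏ⁺¹⁾ = 𝓡(i h⁽ᵏ⁾)`. -/
def IsHierarchy {m : ℕ} (h : ℕ → DVec m) : Prop :=
  Complex.I • h 0 = Complex.I • dv 0 ∧
  ∀ k, RValue (Complex.I • h k) (Complex.I • h (k + 1))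

/-- The right-hand side `i (h⁽ᵏ⁺²⁾ - χ h⁽ᵏ⁾)` of the `+(k+1)` flow. -/
def flow {m : ℕ} (h : ℕ → DVec m) (χ : ℝ) (k : ℕ) : DVec m :=
  Complex.I • (h (k + 2) - (χ : ℂ) • h k)

/-- `H⁽ʲ'ᵡ⁾ = H⁽ʲ⁾ - χ H⁽ʲ⁻²⁾`, with `H⁽⁻¹⁾ = H⁽⁻²⁾ = 0`. -/
def hamChi {m : ℕ} (Ham : ℕ → DiffPoly m) (χ : ℝ) : ℕ → DiffPoly m
  | 0 => Ham 0
  | 1 => Ham 1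
  | j + 2 => Ham (j + 2) - (χ : ℂ) • Ham j

/-- The integration constants used in `𝓗(δH⁽ᵏ⁺¹'ᵡ⁾/δv̄)`: zero for `k ≥ 1`. For `k = 0` they are
those for which `𝓗(0) = -χ i v`, where `0` is `-χ δH⁽⁻¹⁾/δv̄`. -/
def intConst (m : ℕ) (χ : ℝ) : ℕ → Matrix (Fin m) (Fin m) ℂ
  | 0 => (-(Complex.I * χ / ((m : ℂ) + 1))) • 1
  | _ + 1 => 0

end VectorNLS

end

open VectorNLS

noncomputable section

namespace VectorNLS

variable {m : ℕ}

/-! Three mechanisms carry the theorem; write ε for the power series variable.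

Hamiltonian pair. The two nonlocal terms of 𝓗 combine into `v ᵥ* addTrace Θ` for one anti-Hermitian
potential Θ of v̄ ∧† ω (`HValue.exists_potential`). By `pairing_vecMul_addTrace` they have the form
-B* D_x⁻¹ B with B = v̄ ∧† relative to `traceForm`, so skew-adjointness is integration by parts. In
the Schouten bracket everything cancels cyclically except a remainder in which the coefficient v is
varied. `isTotalDeriv_cyclic` writes it as a total derivative, using a Bianchi type identity and the
invariant trilinear form tr([Θ₃, Θ₁]Θ₂). The pencil is treated at once.

Locality and Hamiltonians. The generating series of h⁽ᵏ⁾ and of its potentials fit into a matrix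
`laxPi` of trace one. The potentials are defined by the quadratic relation that makes it of rank
one, hence a projector. The off-diagonal entries of ε Π_x = [L, Π] are the recursion. Idempotency
forces the remaining entries (`lax_equation`), and these say that the algebraic potentials really
are inverse derivatives (`Dx_pot`). Varying Π both in v̄ and in ε, the total derivative of tr(Π[δΠ,
ε∂_εΠ]) gives the trace identity. It shows that i/(k+1) times the trace of the potential of order
k+1 is a Hamiltonian density for -h⁽ᵏ⁾ (`varDeriv_trace_pot`).

Commutation. Along the flow of i h⁽ᵏ⁾ the coefficients P_l of Π evolve by i times the sum of [P_j,
P_{l+k-j}] over j ≤ k (`map_evol_laxCoeff`). Exchanging the flow k with the coefficient l+1 and the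
flow l with the coefficient k+1 changes this sum only by terms that cancel in pairs
(`laxFlow_symm`).

Primitives are pinned down throughout by `eq_of_Dx_eq`: the kernel of D_x consists of constants. -/

/-! ### Conjugation and the total derivative -/

lemma conj_C (c : ℂ) : conj (MvPolynomial.C c : DiffPoly m) = MvPolynomial.C (star c) := by
  simp [conj]

lemma conj_X (p : JetVar m) :
    conj (MvPolynomial.X p : DiffPoly m) = MvPolynomial.X (!p.1, p.2.1, p.2.2) := by
  simp [conj]

lemma conj_smul (c : ℂ) (f : DiffPoly m) : conj (c • f) = star c • conj f := by
  rw [MvPolynomial.smul_eq_C_mul, MvPolynomial.smul_eq_C_mul, map_mul, conj_C]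

@[simp] lemma conj_conj (f : DiffPoly m) : conj (conj f) = f := by
  induction f using MvPolynomial.induction_on with
  | C a => simp [conj_C]
  | add p q hp hq => simp [hp, hq]
  | mul_X p i hp => simp [hp, conj_X]

@[simp] lemma Dx_X (p : JetVar m) :
    Dx (MvPolynomial.X p : DiffPoly m) = MvPolynomial.X (p.1, p.2.1, p.2.2 + 1) := by
  simp [Dx]

@[simp] lemma Dx_C (c : ℂ) : Dx (MvPolynomial.C c : DiffPoly m) = 0 :=
  MvPolynomial.derivation_C _ _

lemma Dx_mul (f g : DiffPoly m) : Dx (f * g) = Dx f * g + f * Dx g := by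
  rw [Derivation.leibniz]; simp only [smul_eq_mul]; ring

lemma conj_Dx (f : DiffPoly m) : conj (Dx f) = Dx (conj f) := by
  induction f using MvPolynomial.induction_on with
  | C a => simp [conj_C]
  | add p q hp hq => simp [hp, hq]
  | mul_X p i hp => simp [hp, conj_X]

lemma conj_iterate_Dx (n : ℕ) (f : DiffPoly m) : conj (Dx^[n] f) = Dx^[n] (conj f) := by
  induction n with
  | zero => rfl
  | succ n ih => rw [Function.iterate_succ_apply', Function.iterate_succ_apply', conj_Dx, ih]

@[simp] lemma vconj_vconj (A : DVec m) : vconj (vconj A) = A := by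
  ext j; simp [vconj]

@[simp] lemma vconj_dv (n : ℕ) : vconj (dv n : DVec m) = dvbar n := by
  ext j; simp [vconj, dv, dvbar, conj_X]

@[simp] lemma vconj_dvbar (n : ℕ) : vconj (dvbar n : DVec m) = dv n := by
  ext j; simp [vconj, dv, dvbar, conj_X]

@[simp] lemma vDx_dv (n : ℕ) : vDx (dv n : DVec m) = dv (n + 1) := by
  ext j; simp [vDx, dv]

@[simp] lemma vDx_dvbar (n : ℕ) : vDx (dvbar n : DVec m) = dvbar (n + 1) := by
  ext j; simp [vDx, dvbar]

lemma vDx_vconj (A : DVec m) : vDx (vconj A) = vconj (vDx A) := by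
  ext j; simp [vconj, vDx, conj_Dx]

lemma vconj_add (A B : DVec m) : vconj (A + B) = vconj A + vconj B := by
  ext j; simp [vconj]

lemma vconj_neg (A : DVec m) : vconj (-A) = -vconj A := by
  ext j; simp [vconj]

lemma vconj_smul (c : ℂ) (A : DVec m) : vconj (c • A) = star c • vconj A := by
  ext j : 1; simp [vconj, conj_smul]

lemma vconj_mul (f : DiffPoly m) (A : DVec m) : vconj (f • A) = conj f • vconj A := by
  ext j : 1; simp [vconj]

lemma conj_dotProduct (A B : DVec m) : conj (A ⬝ᵥ B) = vconj A ⬝ᵥ vconj B := by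
  simp [dotProduct, vconj]

lemma Dx_dotProduct (A B : DVec m) : Dx (A ⬝ᵥ B) = vDx A ⬝ᵥ B + A ⬝ᵥ vDx B := by
  simp only [dotProduct, map_sum, Dx_mul, vDx, Finset.sum_add_distrib]

/-! ### Prolonged derivations -/

/-- The derivation commuting with `Dx` with prescribed values on `v` and `v̄`. -/
def prolong (F : Bool → Fin m → DiffPoly m) : Derivation ℂ (DiffPoly m) (DiffPoly m) :=
  MvPolynomial.mkDerivation ℂ (fun p => Dx^[p.2.2] (F p.1 p.2.1))

@[simp] lemma prolong_X (F : Bool → Fin m → DiffPoly m) (p : JetVar m) :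
    prolong F (MvPolynomial.X p) = Dx^[p.2.2] (F p.1 p.2.1) := by
  simp [prolong]

lemma evol_eq_prolong (X : DVec m) :
    evol X = prolong (fun b j => if b then conj (X j) else X j) := rfl

/-- The commutator of two derivations is a derivation, so it suffices that it vanishes on jet
variables. Real flows (`evol`) and variations of v̄ alone (`barVariation`) are both prolongations
and inherit this. -/
lemma prolong_Dx (F : Bool → Fin m → DiffPoly m) (f : DiffPoly m) :
    prolong F (Dx f) = Dx (prolong F f) := by
  have h : ⁅prolong F, Dx (m := m)⁆ = 0 := by
    apply MvPolynomial.derivation_ext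
    intro p
    rw [Derivation.commutator_apply, Dx_X, prolong_X, prolong_X]
    simp [Function.iterate_succ_apply']
  have := congrArg (fun d : Derivation ℂ (DiffPoly m) (DiffPoly m) => d f) h
  simp only [Derivation.commutator_apply, Derivation.zero_apply] at this
  exact sub_eq_zero.mp this

lemma evol_Dx (X : DVec m) (f : DiffPoly m) : evol X (Dx f) = Dx (evol X f) := by
  rw [evol_eq_prolong, prolong_Dx]

lemma conj_evol (X : DVec m) (f : DiffPoly m) : conj (evol X f) = evol X (conj f) := by
  rw [evol_eq_prolong]
  induction f using MvPolynomial.induction_on with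
  | C a => simp [conj_C]
  | add p q hp hq => simp [hp, hq]
  | mul_X p i hp =>
    obtain ⟨b, j, n⟩ := i
    cases b <;> simp [hp, conj_X, conj_iterate_Dx]

lemma vevol_vconj (X Y : DVec m) : vevol X (vconj Y) = vconj (vevol X Y) := by
  ext j; simp [vevol, vconj, conj_evol]

lemma vevol_vDx (X Y : DVec m) : vevol X (vDx Y) = vDx (vevol X Y) := by
  ext j; simp [vevol, vDx, evol_Dx]

@[simp] lemma vevol_dv (X : DVec m) : vevol X (dv 0) = X := by
  ext j; simp [vevol, dv, evol_eq_prolong]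

@[simp] lemma vevol_dvbar (X : DVec m) : vevol X (dvbar 0) = vconj X := by
  rw [← vconj_dv, vevol_vconj, vevol_dv]

lemma derivation_mul (d : Derivation ℂ (DiffPoly m) (DiffPoly m)) (f g : DiffPoly m) :
    d (f * g) = d f * g + f * d g := by
  rw [Derivation.leibniz]; simp only [smul_eq_mul]; ring

/-! ### Constant terms -/

lemma constantCoeff_derivation (d : Derivation ℂ (DiffPoly m) (DiffPoly m))
    (hd : ∀ p, MvPolynomial.constantCoeff (d (MvPolynomial.X p)) = 0) (f : DiffPoly m) :
    MvPolynomial.constantCoeff (d f) = 0 := by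
  induction f using MvPolynomial.induction_on with
  | C a => simp
  | add p q hp hq => simp [hp, hq]
  | mul_X p i hp => simp [hd]

lemma constantCoeff_Dx (f : DiffPoly m) : MvPolynomial.constantCoeff (Dx f) = 0 :=
  constantCoeff_derivation _ (by simp) f

lemma constantCoeff_prolong (F : Bool → Fin m → DiffPoly m)
    (hF : ∀ b j, MvPolynomial.constantCoeff (F b j) = 0) (f : DiffPoly m) :
    MvPolynomial.constantCoeff (prolong F f) = 0 := by
  refine constantCoeff_derivation _ (fun p => ?_) f
  obtain ⟨b, j, n⟩ := p
  rw [prolong_X]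
  cases n with
  | zero => exact hF b j
  | succ n => simp only [Function.iterate_succ_apply', constantCoeff_Dx]

lemma constantCoeff_conj (f : DiffPoly m) :
    MvPolynomial.constantCoeff (conj f) = star (MvPolynomial.constantCoeff f) := by
  induction f using MvPolynomial.induction_on with
  | C a => simp [conj_C]
  | add p q hp hq => simp [hp, hq]
  | mul_X p i hp => simp [conj_X]

lemma constantCoeff_evol (X : DVec m) (hX : ∀ j, MvPolynomial.constantCoeff (X j) = 0)
    (f : DiffPoly m) : MvPolynomial.constantCoeff (evol X f) = 0 := by
  rw [evol_eq_prolong]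
  refine constantCoeff_prolong _ (fun b j => ?_) f
  cases b <;> simp [hX, constantCoeff_conj]

/-! ### The kernel of `Dx` -/

/-- The commutator of ∂/∂v_{n+1} with D_x is ∂/∂v_n. It lets the dependence of a primitive on its
highest variables be read off its derivative. -/
lemma pderiv_succ_Dx (b : Bool) (j : Fin m) (n : ℕ) (f : DiffPoly m) :
    MvPolynomial.pderiv (b, j, n + 1) (Dx f) =
      Dx (MvPolynomial.pderiv (b, j, n + 1) f) + MvPolynomial.pderiv (b, j, n) f := by
  have h : ⁅MvPolynomial.pderiv (R := ℂ) ((b, j, n + 1) : JetVar m), Dx (m := m)⁆ =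
      MvPolynomial.pderiv (b, j, n) := by
    apply MvPolynomial.derivation_ext
    intro p
    obtain ⟨c, i, k⟩ := p
    rw [Derivation.commutator_apply, Dx_X]
    simp only [MvPolynomial.pderiv_X, Pi.single_apply, Prod.mk.injEq, add_left_inj]
    split_ifs <;> simp
  have := congrArg (fun d : Derivation ℂ (DiffPoly m) (DiffPoly m) => d f) h
  simp only [Derivation.commutator_apply] at this
  rw [← this]; ring

lemma exists_forall_pderiv_eq_zero (f : DiffPoly m) :
    ∃ M, ∀ b j n, M ≤ n → MvPolynomial.pderiv (b, j, n) f = 0 := by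
  refine ⟨(f.vars.image fun p => p.2.2).sup id + 1, fun b j n hn => ?_⟩
  apply MvPolynomial.pderiv_eq_zero_of_notMem_vars
  intro h
  have := Finset.le_sup (f := id) (Finset.mem_image_of_mem (fun p : JetVar m => p.2.2) h)
  simp only [id] at this
  omega

/-- If `Dx g` does not depend on derivatives of order above `n`, then `g` does not depend on
derivatives of order `n` and above. -/
lemma pderiv_eq_zero_of_Dx {g : DiffPoly m} {b : Bool} {j : Fin m} {n : ℕ}
    (h : ∀ k, n < k → MvPolynomial.pderiv (b, j, k) (Dx g) = 0) (k : ℕ) (hk : n ≤ k) :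
    MvPolynomial.pderiv (b, j, k) g = 0 := by
  obtain ⟨M, hM⟩ := exists_forall_pderiv_eq_zero g
  -- Descending induction on the order k: i bounds the distance to the order M from which g is
  -- certainly independent of the variable.
  suffices H : ∀ i k, n ≤ k → M ≤ k + i → MvPolynomial.pderiv (b, j, k) g = 0 from
    H M k hk (by omega)
  intro i
  induction i with
  | zero => intro k _ hk; exact hM _ _ _ (by omega)
  | succ i ih =>
    intro k hk hi
    have h1 := pderiv_succ_Dx b j k g
    rw [h (k + 1) (by omega), ih (k + 1) (by omega) (by omega), map_zero, zero_add] at h1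
    exact h1.symm

/-- In characteristic zero ∂_i multiplies a coefficient by a nonzero exponent, so a nonconstant
monomial is detected by any variable occurring in it. -/
lemma eq_C_of_pderiv_eq_zero {σ : Type*} {f : MvPolynomial σ ℂ}
    (h : ∀ i, MvPolynomial.pderiv i f = 0) :
    f = MvPolynomial.C (MvPolynomial.constantCoeff f) := by
  classical
  ext s
  rw [MvPolynomial.coeff_C]
  split_ifs with hs
  · rw [← hs]; rfl
  · obtain ⟨i, hi⟩ : ∃ i, s i ≠ 0 := by
      by_contra hc
      push Not at hc
      exact hs (Finsupp.ext fun i => (hc i).symm)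
    have h1 := congrArg (MvPolynomial.coeff (s - Finsupp.single i 1)) (h i)
    rw [MvPolynomial.coeff_pderiv, tsub_add_cancel_of_le
      (Finsupp.single_le_iff.mpr (Nat.one_le_iff_ne_zero.mpr hi)), MvPolynomial.coeff_zero] at h1
    refine (mul_eq_zero.mp h1).resolve_right ?_
    exact Nat.cast_add_one_ne_zero _

/-- With D_x f = 0, `pderiv_eq_zero_of_Dx` removes every variable from f, and only the constant term
remains. This is the source of all uniqueness of inverse derivatives below. -/
lemma eq_zero_of_Dx_eq_zero {f : DiffPoly m} (h : Dx f = 0)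
    (h0 : MvPolynomial.constantCoeff f = 0) : f = 0 := by
  rw [eq_C_of_pderiv_eq_zero (f := f), h0, map_zero]
  rintro ⟨b, j, n⟩
  exact pderiv_eq_zero_of_Dx (n := 0) (by simp [h]) n (Nat.zero_le _)

lemma eq_of_Dx_eq {f g : DiffPoly m} (h : Dx f = Dx g)
    (h0 : MvPolynomial.constantCoeff f = MvPolynomial.constantCoeff g) : f = g :=
  sub_eq_zero.mp (eq_zero_of_Dx_eq_zero (by rw [map_sub, h, sub_self]) (by rw [map_sub, h0, sub_self]))

/-! ### Total derivatives -/

lemma IsTotalDeriv.add {f g : DiffPoly m} (hf : IsTotalDeriv f) (hg : IsTotalDeriv g) :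
    IsTotalDeriv (f + g) := by
  obtain ⟨a, rfl⟩ := hf
  obtain ⟨b, rfl⟩ := hg
  exact ⟨a + b, map_add _ _ _⟩

lemma IsTotalDeriv.sum {ι : Type*} (s : Finset ι) {f : ι → DiffPoly m}
    (hf : ∀ i ∈ s, IsTotalDeriv (f i)) : IsTotalDeriv (∑ i ∈ s, f i) := by
  classical
  induction s using Finset.induction_on with
  | empty => exact ⟨0, by simp⟩
  | insert a s ha ih =>
    rw [Finset.sum_insert ha]
    exact (hf _ (Finset.mem_insert_self _ _)).add
      (ih fun i hi => hf i (Finset.mem_insert_of_mem hi))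

/-- The fundamental lemma of the calculus of variations. -/
lemma eq_zero_of_forall_isTotalDeriv_mul (j : Fin m) {f : DiffPoly m}
    (h : ∀ w, IsTotalDeriv (w * f)) : f = 0 := by
  obtain ⟨M, hM⟩ := exists_forall_pderiv_eq_zero f
  -- The test function is y² with y of higher order than f. If y² f = D_x g, then g is independent
  -- of y while ∂g/∂v̄_M = 2yf depends on it linearly. Commuting the mixed partial derivatives gives
  -- 2f = 0. A linear test function y would give no contradiction.
  set y : DiffPoly m := MvPolynomial.X (true, j, M + 1) with hy
  obtain ⟨g, hg⟩ := h (y ^ 2)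
  have hd : ∀ k, M + 1 < k → MvPolynomial.pderiv (true, j, k) (Dx g) = 0 := by
    intro k hk
    have : MvPolynomial.pderiv (true, j, k) y = 0 :=
      MvPolynomial.pderiv_X_of_ne (by simp; omega)
    rw [hg, derivation_mul, hM _ _ _ (by omega), Derivation.leibniz_pow, this]
    simp
  have hg0 := pderiv_eq_zero_of_Dx hd (M + 1) le_rfl
  have h1 : MvPolynomial.pderiv (true, j, M) g = 2 * y * f := by
    have := pderiv_succ_Dx true j M g
    rw [hg0, map_zero, zero_add, hg, derivation_mul, hM _ _ _ (by omega),
      Derivation.leibniz_pow, hy, MvPolynomial.pderiv_X_self, ← hy] at this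
    rw [← this]; simp
  have h2 : MvPolynomial.pderiv (true, j, M + 1) (2 * y * f) = 2 * f := by
    rw [derivation_mul, derivation_mul, hM _ _ _ (by omega), hy, MvPolynomial.pderiv_X_self]
    have : MvPolynomial.pderiv (true, j, M + 1) (2 : DiffPoly m) = 0 :=
      MvPolynomial.pderiv_C (a := (2 : ℂ))
    rw [this]; ring
  have h3 : MvPolynomial.pderiv (true, j, M + 1) (MvPolynomial.pderiv (true, j, M) g) = 0 := by
    have hc : ⁅MvPolynomial.pderiv (R := ℂ) ((true, j, M + 1) : JetVar m),
        MvPolynomial.pderiv (R := ℂ) (true, j, M)⁆ = 0 := by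
      apply MvPolynomial.derivation_ext
      intro p
      rw [Derivation.commutator_apply, MvPolynomial.pderiv_X, MvPolynomial.pderiv_X]
      simp only [Pi.single_apply]
      split_ifs <;> simp
    have := congrArg (fun d : Derivation ℂ (DiffPoly m) (DiffPoly m) => d g) hc
    simp only [Derivation.commutator_apply, Derivation.zero_apply, hg0, map_zero, sub_zero] at this
    exact this
  rw [h1, h2] at h3
  exact (mul_eq_zero.mp h3).resolve_left two_ne_zero

/-! ### Duality between the pairing, the wedge product and the trace form -/

/-- Anti-Hermitian matrices of differential polynomials. -/
def IsAntiHerm (K : Matrix (Fin m) (Fin m) (DiffPoly m)) : Prop := ∀ a b, conj (K a b) = -K b a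

/-- The matrix `M + tr M`, which multiplies `v` in the nonlocal terms of `𝓗`. -/
def addTrace (M : Matrix (Fin m) (Fin m) (DiffPoly m)) : Matrix (Fin m) (Fin m) (DiffPoly m) :=
  M + M.trace • 1

lemma IsAntiHerm.trace {K : Matrix (Fin m) (Fin m) (DiffPoly m)} (hK : IsAntiHerm K) :
    conj K.trace = -K.trace := by
  simp only [Matrix.trace, map_sum, Matrix.diag, hK _ _, Finset.sum_neg_distrib]

lemma IsAntiHerm.addTrace {K : Matrix (Fin m) (Fin m) (DiffPoly m)} (hK : IsAntiHerm K) :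
    IsAntiHerm (addTrace K) := by
  intro a b
  simp only [VectorNLS.addTrace, Matrix.add_apply, Matrix.smul_apply, map_add, hK a b, smul_eq_mul,
    map_mul, hK.trace, Matrix.one_apply, eq_comm (a := b)]
  split_ifs
  · simp; ring
  · simp

lemma IsAntiHerm.map_evol {K : Matrix (Fin m) (Fin m) (DiffPoly m)} (hK : IsAntiHerm K)
    (X : DVec m) : IsAntiHerm (K.map (evol X)) := by
  intro a b
  simp [Matrix.map_apply, conj_evol, hK a b]

lemma IsAntiHerm.vconj_vecMul {K : Matrix (Fin m) (Fin m) (DiffPoly m)} (hK : IsAntiHerm K)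
    (u : DVec m) : vconj (u ᵥ* K) = -(K *ᵥ vconj u) := by
  ext b : 1
  simp [vconj, Matrix.vecMul, Matrix.mulVec, dotProduct, hK _ _, mul_comm]

lemma IsAntiHerm.lie {K L : Matrix (Fin m) (Fin m) (DiffPoly m)} (hK : IsAntiHerm K)
    (hL : IsAntiHerm L) : IsAntiHerm (K * L - L * K) := by
  intro a b
  simp only [Matrix.sub_apply, Matrix.mul_apply, map_sub, map_sum, map_mul, hK _ _, hL _ _]
  rw [← Finset.sum_sub_distrib, ← Finset.sum_sub_distrib, ← Finset.sum_neg_distrib]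
  exact Finset.sum_congr rfl fun _ _ => by ring

lemma pairing_comm (ω X : DVec m) : pairing ω X = pairing X ω := by
  rw [pairing, pairing, dotProduct_comm (vconj X), dotProduct_comm X, add_comm]

lemma pairing_add_right (ω X Y : DVec m) : pairing ω (X + Y) = pairing ω X + pairing ω Y := by
  simp only [pairing, vconj_add, dotProduct_add]; ring

lemma pairing_smul_right (a : ℝ) (ω X : DVec m) :
    pairing ω ((a : ℂ) • X) = (a : ℂ) • pairing ω X := by
  simp only [pairing, vconj_smul, Complex.star_def, Complex.conj_ofReal, dotProduct_smul, smul_add]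

lemma pairing_I_smul (ω X : DVec m) :
    pairing ω (Complex.I • X) = -pairing (Complex.I • ω) X := by
  simp only [pairing, vconj_smul, Complex.star_def, Complex.conj_I, dotProduct_smul,
    smul_dotProduct]
  module

lemma Dx_pairing (ω X : DVec m) :
    Dx (pairing ω X) = pairing (vDx ω) X + pairing ω (vDx X) := by
  simp only [pairing, map_add, Dx_dotProduct, vDx_vconj]; ring

lemma pairing_vecMul {K : Matrix (Fin m) (Fin m) (DiffPoly m)} (hK : IsAntiHerm K)
    (ω u : DVec m) : pairing ω (u ᵥ* K) = vconj ω ⬝ᵥ (u ᵥ* K) - vconj u ⬝ᵥ (ω ᵥ* K) := by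
  rw [pairing, hK.vconj_vecMul, dotProduct_neg, dotProduct_mulVec, dotProduct_comm (ω ᵥ* K),
    sub_eq_add_neg]

lemma pairing_vecMul_swap {K : Matrix (Fin m) (Fin m) (DiffPoly m)} (hK : IsAntiHerm K)
    (ω u : DVec m) : pairing ω (u ᵥ* K) = -pairing u (ω ᵥ* K) := by
  rw [pairing_vecMul hK, pairing_vecMul hK]; ring

lemma trace_mul_hwedge (K : Matrix (Fin m) (Fin m) (DiffPoly m)) (u ω : DVec m) :
    (K * hwedge (vconj u) ω).trace = vconj u ⬝ᵥ (ω ᵥ* K) - vconj ω ⬝ᵥ (u ᵥ* K) := by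
  rw [hwedge, vconj_vconj, Matrix.mul_sub, Matrix.trace_sub, Matrix.mul_vecMulVec,
    Matrix.mul_vecMulVec, Matrix.trace_vecMulVec, Matrix.trace_vecMulVec,
    dotProduct_comm, dotProduct_comm (K *ᵥ vconj ω), dotProduct_mulVec, dotProduct_mulVec,
    dotProduct_comm, dotProduct_comm (u ᵥ* K)]

lemma pairing_vecMul_eq_trace {K : Matrix (Fin m) (Fin m) (DiffPoly m)} (hK : IsAntiHerm K)
    (ω u : DVec m) : pairing ω (u ᵥ* K) = -(K * hwedge (vconj u) ω).trace := by
  rw [pairing_vecMul hK, trace_mul_hwedge]; ring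

/-- The invariant form `tr(MN) + tr M tr N`. -/
def traceForm (M N : Matrix (Fin m) (Fin m) (DiffPoly m)) : DiffPoly m :=
  (M * N).trace + M.trace * N.trace

lemma trace_addTrace_mul (M N : Matrix (Fin m) (Fin m) (DiffPoly m)) :
    (addTrace M * N).trace = traceForm M N := by
  simp [addTrace, traceForm, Matrix.add_mul]

lemma traceForm_comm (M N : Matrix (Fin m) (Fin m) (DiffPoly m)) :
    traceForm M N = traceForm N M := by
  rw [traceForm, traceForm, Matrix.trace_mul_comm, mul_comm M.trace]

lemma traceForm_add (M N L : Matrix (Fin m) (Fin m) (DiffPoly m)) :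
    traceForm M (N + L) = traceForm M N + traceForm M L := by
  simp only [traceForm, Matrix.mul_add, Matrix.trace_add]; ring

lemma map_derivation_mul {A : Type*} [CommRing A] [Algebra ℂ A] (d : Derivation ℂ A A)
    {k l n : Type*} [Fintype l] (M : Matrix k l A) (N : Matrix l n A) :
    (M * N).map d = M.map d * N + M * N.map d := by
  ext i j
  simp only [Matrix.map_apply, Matrix.mul_apply, Matrix.add_apply, map_sum, Derivation.leibniz,
    smul_eq_mul]
  rw [← Finset.sum_add_distrib]
  exact Finset.sum_congr rfl fun _ _ => by ring

lemma derivation_trace {A : Type*} [CommRing A] [Algebra ℂ A] (d : Derivation ℂ A A)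
    {n : Type*} [Fintype n] (M : Matrix n n A) : d M.trace = (M.map d).trace := by
  simp [Matrix.trace]

lemma Dx_traceForm (M N : Matrix (Fin m) (Fin m) (DiffPoly m)) :
    Dx (traceForm M N) = traceForm (M.map Dx) N + traceForm M (N.map Dx) := by
  simp only [traceForm, map_add, derivation_trace, map_derivation_mul, Dx_mul, Matrix.trace_add]
  ring

/-- The wedge product is, up to sign, the adjoint of the action of anti-Hermitian matrices. With u =
v it exhibits the nonlocal part of 𝓗 as -B* D_x⁻¹ B, where B = v̄ ∧†. -/
lemma pairing_vecMul_addTrace {K : Matrix (Fin m) (Fin m) (DiffPoly m)} (hK : IsAntiHerm K)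
    (ω u : DVec m) : pairing ω (u ᵥ* addTrace K) = -traceForm K (hwedge (vconj u) ω) := by
  rw [pairing_vecMul_eq_trace hK.addTrace, trace_addTrace_mul]

lemma map_evol_hwedge (X u ω : DVec m) :
    (hwedge (vconj u) ω).map (evol X) =
      hwedge (vconj (vevol X u)) ω + hwedge (vconj u) (vevol X ω) := by
  ext a b : 1
  simp only [hwedge, Matrix.map_apply, Matrix.sub_apply, vecMulVec_apply, map_sub, derivation_mul,
    Matrix.add_apply, vconj, vevol, ← conj_evol, conj_conj]
  ring

lemma vevol_vecMul (X u : DVec m) (K : Matrix (Fin m) (Fin m) (DiffPoly m)) :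
    vevol X (u ᵥ* K) = vevol X u ᵥ* K + u ᵥ* K.map (evol X) := by
  ext b : 1
  simp only [vevol, Matrix.vecMul, dotProduct, map_sum, derivation_mul, Pi.add_apply,
    Finset.sum_add_distrib, Matrix.map_apply]

lemma map_evol_addTrace (X : DVec m) (K : Matrix (Fin m) (Fin m) (DiffPoly m)) :
    (addTrace K).map (evol X) = addTrace (K.map (evol X)) := by
  ext a b
  simp only [addTrace, Matrix.map_apply, Matrix.add_apply, Matrix.smul_apply, map_add, smul_eq_mul,
    derivation_mul, ← derivation_trace, Matrix.one_apply]
  split_ifs <;> simp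

lemma vevol_add (X Y Z : DVec m) : vevol X (Y + Z) = vevol X Y + vevol X Z := by
  ext j; simp [vevol]

lemma vevol_smul (X : DVec m) (c : ℂ) (Y : DVec m) : vevol X (c • Y) = c • vevol X Y := by
  ext j : 1; simp [vevol]

/-! ### The pencil is Hamiltonian -/

/-- `Θ` is an anti-Hermitian potential `D_x⁻¹(v̄ ∧† ω)`. -/
def IsPotential (ω : DVec m) (Θ : Matrix (Fin m) (Fin m) (DiffPoly m)) : Prop :=
  IsAntiHerm Θ ∧ Θ.map Dx = hwedge (dvbar 0) ω

/-- The value of `a 𝓗 + b 𝓘` on `ω` for a given potential. -/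
def pencil (a b : ℝ) (ω : DVec m) (Θ : Matrix (Fin m) (Fin m) (DiffPoly m)) : DVec m :=
  (a : ℂ) • (vDx ω + dv 0 ᵥ* addTrace Θ) + (b : ℂ) • (Complex.I • ω)

lemma hdot_dvbar (ω : DVec m) :
    hdot (dvbar 0) (Complex.I • ω) = (Complex.I / 2) • (hwedge (dvbar 0) ω).trace := by
  rw [hdot, hwedge, vconj_dvbar, vconj_smul, trace_sub, trace_vecMulVec, trace_vecMulVec,
    dotProduct_smul, smul_dotProduct, Complex.star_def, Complex.conj_I]
  module

/-- The scalar primitive and (i/2) tr Θ have the same derivative and, by the choice of tr C, the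
same constant term. Hence -2i s = tr Θ, and both nonlocal terms merge into `addTrace Θ`.
Anti-Hermiticity of Θ also follows by comparing derivatives and constants. -/
lemma HValue.exists_potential {C : Matrix (Fin m) (Fin m) ℂ} (hC : Cᴴ = -C) {ω X : DVec m}
    (h : HValue C ω X) : ∃ Θ, IsPotential ω Θ ∧ X = vDx ω + dv 0 ᵥ* addTrace Θ := by
  obtain ⟨s, Θ, hs, hΘ, rfl⟩ := h
  have hD : Θ.map Dx = hwedge (dvbar 0) ω := by
    exact Matrix.ext fun a b => (hΘ a b).1
  have hs' : s = (Complex.I / 2) • Θ.trace := by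
    apply eq_of_Dx_eq
    · rw [hs.1, Derivation.map_smul, derivation_trace, hD, hdot_dvbar]
    · rw [hs.2, MvPolynomial.constantCoeff_smul, Matrix.trace, Matrix.trace, map_sum, smul_eq_mul]
      congr 1
      exact Finset.sum_congr rfl fun a _ => (hΘ a a).2.symm
  refine ⟨Θ, ⟨fun a b => ?_, hD⟩, ?_⟩
  · apply eq_of_Dx_eq
    · rw [← conj_Dx, map_neg, (hΘ a b).1, (hΘ b a).1]
      simp only [hwedge, Matrix.sub_apply, vecMulVec_apply, vconj_dvbar, map_sub, map_mul]
      simp only [dv, dvbar, conj_X, vconj, conj_conj, Bool.not_true, Bool.not_false]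
      ring
    · rw [constantCoeff_conj, map_neg, (hΘ a b).2, (hΘ b a).2]
      have := congrFun (congrFun hC b) a
      simpa using this
  · have hI : (2 * Complex.I) * (Complex.I / 2) = -1 := by linear_combination Complex.I_mul_I
    rw [hs', addTrace, Matrix.vecMul_add, Matrix.vecMul_smul, Matrix.vecMul_one, ← smul_assoc,
      smul_smul, hI, neg_one_smul]
    module

lemma pairing_pencil (a b : ℝ) (η ω : DVec m) (Θ : Matrix (Fin m) (Fin m) (DiffPoly m)) :
    pairing η (pencil a b ω Θ) = (a : ℂ) • pairing η (vDx ω) +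
      (a : ℂ) • pairing η (dv 0 ᵥ* addTrace Θ) + (b : ℂ) • pairing η (Complex.I • ω) := by
  rw [pencil, pairing_add_right, pairing_smul_right, pairing_smul_right, pairing_add_right, smul_add]

/-- By duality the nonlocal terms are -`traceForm` of one potential with the derivative of the
other, so together they are an exact derivative. The terms with b cancel because i is skew for the
pairing. -/
lemma pairing_pencil_add (a b : ℝ) {ω₁ ω₂ : DVec m} {Θ₁ Θ₂ : Matrix (Fin m) (Fin m) (DiffPoly m)}
    (h₁ : IsPotential ω₁ Θ₁) (h₂ : IsPotential ω₂ Θ₂) :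
    pairing ω₁ (pencil a b ω₂ Θ₂) + pairing ω₂ (pencil a b ω₁ Θ₁) =
      Dx ((a : ℂ) • (pairing ω₁ ω₂ - traceForm Θ₁ Θ₂)) := by
  have e1 := pairing_vecMul_addTrace h₂.1 ω₁ (dv 0)
  have e2 := pairing_vecMul_addTrace h₁.1 ω₂ (dv 0)
  rw [vconj_dv, ← h₁.2] at e1
  rw [vconj_dv, ← h₂.2] at e2
  rw [pairing_pencil, pairing_pencil, e1, e2, pairing_I_smul ω₁, pairing_comm ω₂ (Complex.I • ω₁),
    Derivation.map_smul, map_sub, Dx_pairing, Dx_traceForm, pairing_comm ω₂ (vDx ω₁),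
    traceForm_comm Θ₂]
  module

/-- When X₃ differentiates the pencil it hits either ω₁ or the coefficient v. The first contribution
is moved onto the pencil at ω₂ by skewness, and the resulting difference of pairings cancels in the
cyclic sum. The last line collects the variations of v, once outside and once inside the inverse
derivative. -/
lemma lieTerm_pencil (a b : ℝ) {ω₁ ω₂ : DVec m} {Θ₁ Θ₂ : Matrix (Fin m) (Fin m) (DiffPoly m)}
    (h₁ : IsPotential ω₁ Θ₁) (h₂ : IsPotential ω₂ Θ₂) (X₃ : DVec m) :
    lieTerm (pencil a b ω₁ Θ₁) ω₂ X₃ =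
      pairing (vevol (pencil a b ω₁ Θ₁) ω₂) X₃ - pairing (vevol X₃ ω₁) (pencil a b ω₂ Θ₂) +
      Dx ((a : ℂ) • (pairing ω₂ (vevol X₃ ω₁) - traceForm (Θ₁.map (evol X₃)) Θ₂)) +
      (a : ℂ) • (pairing ω₂ (X₃ ᵥ* addTrace Θ₁) - pairing ω₁ (X₃ ᵥ* addTrace Θ₂)) := by
  set e := vevol X₃ ω₁ with he
  set M := Θ₁.map (evol X₃) with hM
  have hX : vevol X₃ (pencil a b ω₁ Θ₁) = (a : ℂ) • (vDx e + (X₃ ᵥ* addTrace Θ₁ +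
      dv 0 ᵥ* addTrace M)) + (b : ℂ) • (Complex.I • e) := by
    simp only [pencil, vevol_add, vevol_smul, vevol_vDx, vevol_vecMul, vevol_dv,
      map_evol_addTrace, he, hM]
  have hDM : M.map Dx = hwedge (vconj X₃) ω₁ + hwedge (vconj (dv 0)) e := by
    have := map_evol_hwedge X₃ (dv 0) ω₁
    rw [vevol_dv, ← he] at this
    rw [← this, vconj_dv, ← h₁.2]
    exact Matrix.ext fun a b => by simp [hM, evol_Dx]
  have e1 := pairing_vecMul_addTrace (h₁.1.map_evol X₃) ω₂ (dv 0)
  rw [← hM, vconj_dv, ← h₂.2] at e1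
  have e2 := pairing_vecMul_addTrace h₂.1 e (dv 0)
  have e3 := pairing_vecMul_addTrace h₂.1 ω₁ X₃
  have e4 : traceForm (M.map Dx) Θ₂ = traceForm Θ₂ (hwedge (vconj X₃) ω₁) +
      traceForm Θ₂ (hwedge (vconj (dv 0)) e) := by
    rw [traceForm_comm, hDM, traceForm_add]
  rw [lieTerm, hX]
  rw [pairing_pencil, Derivation.map_smul, map_sub, Dx_pairing, Dx_traceForm, e4, e2, e3,
    pairing_add_right, pairing_smul_right, pairing_smul_right, pairing_add_right,
    pairing_add_right, e1, pairing_I_smul ω₂, pairing_comm e (vDx ω₂),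
    pairing_comm e (Complex.I • ω₂)]
  module

lemma vecMul_hwedge (u ω η : DVec m) :
    η ᵥ* hwedge (vconj u) ω = (η ⬝ᵥ vconj u) • ω - (η ⬝ᵥ vconj ω) • u := by
  ext b : 1
  simp only [hwedge, vconj_vconj, Matrix.vecMul, dotProduct, Matrix.sub_apply, vecMulVec_apply,
    Pi.sub_apply, Pi.smul_apply, smul_eq_mul, mul_sub, Finset.sum_sub_distrib, Finset.sum_mul,
    mul_assoc]

/-- A Bianchi type identity. After expansion into Hermitian products the terms cancel in the cyclic
sum; the trace part of `addTrace` is indispensable here. -/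
lemma cyclic_pairing_hwedge (u ω₁ ω₂ ω₃ : DVec m) :
    pairing ω₂ (ω₃ ᵥ* addTrace (hwedge (vconj u) ω₁)) +
      pairing ω₃ (ω₁ ᵥ* addTrace (hwedge (vconj u) ω₂)) +
      pairing ω₁ (ω₂ ᵥ* addTrace (hwedge (vconj u) ω₃)) = 0 := by
  have key : ∀ α β γ : DVec m, pairing α (β ᵥ* addTrace (hwedge (vconj u) γ)) =
      (vconj u ⬝ᵥ β) * (vconj α ⬝ᵥ γ) - (vconj γ ⬝ᵥ β) * (vconj α ⬝ᵥ u) +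
      (vconj u ⬝ᵥ γ - vconj γ ⬝ᵥ u) * (vconj α ⬝ᵥ β) +
      ((vconj β ⬝ᵥ u) * (vconj γ ⬝ᵥ α) - (vconj β ⬝ᵥ γ) * (vconj u ⬝ᵥ α) +
      (vconj γ ⬝ᵥ u - vconj u ⬝ᵥ γ) * (vconj β ⬝ᵥ α)) := by
    intro α β γ
    have ht : (hwedge (vconj u) γ).trace = vconj u ⬝ᵥ γ - vconj γ ⬝ᵥ u := by
      rw [hwedge, vconj_vconj, trace_sub, trace_vecMulVec, trace_vecMulVec]
    rw [addTrace, Matrix.vecMul_add, Matrix.vecMul_smul, Matrix.vecMul_one, vecMul_hwedge, ht,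
      sub_eq_add_neg (_ • γ), pairing]
    simp only [vconj_add, vconj_neg, vconj_mul, conj_dotProduct, map_sub, dotProduct_add,
      dotProduct_neg, dotProduct_smul, smul_eq_mul, vconj_vconj, dotProduct_comm _ (vconj _)]
    ring
  rw [key, key, key]
  ring

lemma pairing_pencil_vecMul (a b : ℝ) (α β : DVec m)
    (Θ K : Matrix (Fin m) (Fin m) (DiffPoly m)) :
    pairing α (pencil a b β Θ ᵥ* K) = (a : ℂ) • pairing α (vDx β ᵥ* K) +
      (a : ℂ) • pairing α (dv 0 ᵥ* (addTrace Θ * K)) +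
      (b : ℂ) • pairing α ((Complex.I • β) ᵥ* K) := by
  rw [pencil, Matrix.add_vecMul, Matrix.smul_vecMul, Matrix.smul_vecMul, Matrix.add_vecMul,
    Matrix.vecMul_vecMul, pairing_add_right, pairing_smul_right, pairing_smul_right,
    pairing_add_right, smul_add]

lemma pairing_I_smul_vecMul {K : Matrix (Fin m) (Fin m) (DiffPoly m)} (hK : IsAntiHerm K)
    (α β : DVec m) :
    pairing α ((Complex.I • β) ᵥ* K) = pairing β ((Complex.I • α) ᵥ* K) := by
  rw [Matrix.smul_vecMul, pairing_I_smul, pairing_vecMul_swap hK, neg_neg]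

lemma map_Dx_addTrace (K : Matrix (Fin m) (Fin m) (DiffPoly m)) :
    (addTrace K).map Dx = addTrace (K.map Dx) := by
  ext a b : 1
  simp only [addTrace, Matrix.map_apply, Matrix.add_apply, Matrix.smul_apply, map_add, smul_eq_mul,
    Dx_mul, ← derivation_trace, Matrix.one_apply]
  split_ifs <;> simp

lemma vDx_vecMul (u : DVec m) (K : Matrix (Fin m) (Fin m) (DiffPoly m)) :
    vDx (u ᵥ* K) = vDx u ᵥ* K + u ᵥ* K.map Dx := by
  ext b : 1
  simp only [vDx, Matrix.vecMul, dotProduct, map_sum, Dx_mul, Pi.add_apply,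
    Finset.sum_add_distrib, Matrix.map_apply]

lemma IsPotential.pairing_sub {γ : DVec m} {Θ : Matrix (Fin m) (Fin m) (DiffPoly m)}
    (h : IsPotential γ Θ) (α β : DVec m) :
    pairing α (vDx β ᵥ* addTrace Θ) - pairing β (vDx α ᵥ* addTrace Θ) =
      Dx (pairing α (β ᵥ* addTrace Θ)) -
        pairing α (β ᵥ* addTrace (hwedge (vconj (dv 0)) γ)) := by
  rw [Dx_pairing, vDx_vecMul, map_Dx_addTrace, h.2, vconj_dv, pairing_add_right,
    pairing_vecMul_swap h.1.addTrace β]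
  ring

lemma addTrace_mul_addTrace (K L : Matrix (Fin m) (Fin m) (DiffPoly m)) :
    addTrace K * addTrace L = (K * L - L * K) + addTrace L * addTrace K := by
  have h : ∀ (x y : DiffPoly m), (K + x • 1) * (L + y • 1) =
      (K * L - L * K) + (L + y • 1) * (K + x • 1) := by
    intro x y
    simp only [Matrix.add_mul, Matrix.mul_add, Matrix.smul_mul, Matrix.mul_smul,
        Matrix.one_mul, Matrix.mul_one, smul_add, smul_comm x y]
    abel
  exact h _ _

lemma IsPotential.pairing_lie {α : DVec m} {Θ K L : Matrix (Fin m) (Fin m) (DiffPoly m)}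
    (h : IsPotential α Θ) (hK : IsAntiHerm K) (hL : IsAntiHerm L) :
    pairing α (dv 0 ᵥ* (addTrace K * addTrace L)) - pairing α (dv 0 ᵥ* (addTrace L * addTrace K)) =
      -((K * L - L * K) * Θ.map Dx).trace := by
  rw [addTrace_mul_addTrace, Matrix.vecMul_add, pairing_add_right, add_sub_cancel_right,
    pairing_vecMul_eq_trace (hK.lie hL), vconj_dv, h.2]

lemma derivation_trace_lie_mul {A : Type*} [CommRing A] [Algebra ℂ A] (d : Derivation ℂ A A)
    {n : Type*} [Fintype n] (M N L : Matrix n n A) :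
    d ((L * M - M * L) * N).trace =
      ((L * M - M * L) * N.map d).trace + ((M * N - N * M) * L.map d).trace +
      ((N * L - L * N) * M.map d).trace := by
  rw [derivation_trace, map_derivation_mul, Matrix.map_sub _ (fun _ _ => map_sub d _ _),
    map_derivation_mul, map_derivation_mul]
  simp only [Matrix.sub_mul, Matrix.trace_sub, Matrix.add_mul, Matrix.trace_add]
  rw [Matrix.trace_mul_cycle M N (L.map d), Matrix.trace_mul_cycle M (L.map d) N,
    Matrix.trace_mul_cycle L (M.map d) N, Matrix.trace_mul_cycle L N (M.map d)]
  ring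

/-- The remainder in `lieTerm_pencil`. -/
lemma isTotalDeriv_cyclic (a b : ℝ) {ω₁ ω₂ ω₃ : DVec m}
    {Θ₁ Θ₂ Θ₃ : Matrix (Fin m) (Fin m) (DiffPoly m)}
    (h₁ : IsPotential ω₁ Θ₁) (h₂ : IsPotential ω₂ Θ₂) (h₃ : IsPotential ω₃ Θ₃) :
    IsTotalDeriv
      (pairing ω₂ (pencil a b ω₃ Θ₃ ᵥ* addTrace Θ₁) - pairing ω₁ (pencil a b ω₃ Θ₃ ᵥ* addTrace Θ₂) +
      (pairing ω₃ (pencil a b ω₁ Θ₁ ᵥ* addTrace Θ₂) -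
        pairing ω₂ (pencil a b ω₁ Θ₁ ᵥ* addTrace Θ₃)) +
      (pairing ω₁ (pencil a b ω₂ Θ₂ ᵥ* addTrace Θ₃) -
        pairing ω₃ (pencil a b ω₂ Θ₂ ᵥ* addTrace Θ₁))) := by
  -- The three pairings are primitives of the terms linear in the potentials, up to terms that
  -- vanish by `cyclic_pairing_hwedge`. The trace of the triple product is the primitive of the
  -- terms quadratic in them. The terms with b cancel since pairing α with iβ multiplied by an
  -- anti-Hermitian matrix is symmetric in α and β.
  refine ⟨(a : ℂ) • (pairing ω₂ (ω₃ ᵥ* addTrace Θ₁) + pairing ω₃ (ω₁ ᵥ* addTrace Θ₂) +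
    pairing ω₁ (ω₂ ᵥ* addTrace Θ₃) - ((Θ₃ * Θ₁ - Θ₁ * Θ₃) * Θ₂).trace), ?_⟩
  rw [Derivation.map_smul, map_sub, map_add, map_add, derivation_trace_lie_mul]
  have d1 := h₁.pairing_sub ω₂ ω₃
  have d2 := h₂.pairing_sub ω₃ ω₁
  have d3 := h₃.pairing_sub ω₁ ω₂
  have c := cyclic_pairing_hwedge (dv 0) ω₁ ω₂ ω₃
  have l1 := h₁.pairing_lie h₂.1 h₃.1
  have l2 := h₂.pairing_lie h₃.1 h₁.1
  have l3 := h₃.pairing_lie h₁.1 h₂.1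
  simp only [pairing_pencil_vecMul]
  rw [pairing_I_smul_vecMul h₁.1.addTrace ω₂ ω₃, pairing_I_smul_vecMul h₂.1.addTrace ω₃ ω₁,
    pairing_I_smul_vecMul h₃.1.addTrace ω₁ ω₂]
  simp only [MvPolynomial.smul_eq_C_mul]
  linear_combination (-MvPolynomial.C (a : ℂ)) * (d1 + d2 + d3 - c + l1 + l2 + l3)

lemma isHamiltonianOp_pencil (a b : ℝ) :
    IsHamiltonianOp (m := m) fun ω X => ∃ Θ, IsPotential ω Θ ∧ X = pencil a b ω Θ := by
  constructor
  · rintro ω₁ _ ω₂ _ ⟨Θ₁, h₁, rfl⟩ ⟨Θ₂, h₂, rfl⟩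
    exact ⟨_, (pairing_pencil_add a b h₁ h₂).symm⟩
  · rintro ω₁ _ ω₂ _ ω₃ _ ⟨Θ₁, h₁, rfl⟩ ⟨Θ₂, h₂, rfl⟩ ⟨Θ₃, h₃, rfl⟩
    rw [lieTerm_pencil a b h₁ h₂, lieTerm_pencil a b h₂ h₃, lieTerm_pencil a b h₃ h₁]
    obtain ⟨g, hg⟩ := isTotalDeriv_cyclic a b h₁ h₂ h₃
    refine ⟨(a : ℂ) • (pairing ω₂ (vevol (pencil a b ω₃ Θ₃) ω₁) -
        traceForm (Θ₁.map (evol (pencil a b ω₃ Θ₃))) Θ₂) +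
      (a : ℂ) • (pairing ω₃ (vevol (pencil a b ω₁ Θ₁) ω₂) -
        traceForm (Θ₂.map (evol (pencil a b ω₁ Θ₁))) Θ₃) +
      (a : ℂ) • (pairing ω₁ (vevol (pencil a b ω₂ Θ₂) ω₃) -
        traceForm (Θ₃.map (evol (pencil a b ω₂ Θ₂))) Θ₁) + (a : ℂ) • g, ?_⟩
    rw [map_add, map_add, map_add, Dx.map_smul _ g, hg]
    simp only [smul_add]
    ring

lemma IsHamiltonianOp.mono {L L' : DVec m → DVec m → Prop} (hL : IsHamiltonianOp L)
    (h : ∀ ω X, L' ω X → L ω X) : IsHamiltonianOp L' :=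
  ⟨fun _ _ _ _ h₁ h₂ => hL.1 _ _ _ _ (h _ _ h₁) (h _ _ h₂),
    fun _ _ _ _ _ _ h₁ h₂ h₃ => hL.2 _ _ _ _ _ _ (h _ _ h₁) (h _ _ h₂) (h _ _ h₃)⟩

/-- This is not the pencil at a = 0, b = 1: the domain of that one contains only covectors that
possess a potential. -/
lemma isHamiltonianOp_IGraph : IsHamiltonianOp (m := m) IGraph := by
  have key : ∀ α β γ : DVec m, lieTerm (Complex.I • α) β (Complex.I • γ) =
      pairing (vevol (Complex.I • α) β) (Complex.I • γ) -
        pairing (vevol (Complex.I • γ) α) (Complex.I • β) := by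
    intro α β γ
    rw [lieTerm, vevol_smul, pairing_I_smul β, pairing_comm (Complex.I • β), sub_eq_add_neg]
  constructor
  · rintro ω₁ _ ω₂ _ rfl rfl
    refine ⟨0, ?_⟩
    rw [pairing_I_smul, pairing_comm, map_zero, neg_add_cancel]
  · rintro ω₁ _ ω₂ _ ω₃ _ rfl rfl rfl
    refine ⟨0, ?_⟩
    rw [key, key, key, map_zero]
    ring

theorem isHamiltonianPair_HGraph_IGraph : IsHamiltonianPair (m := m) HGraph IGraph := by
  refine ⟨(isHamiltonianOp_pencil 1 0).mono ?_, isHamiltonianOp_IGraph,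
    fun a b => (isHamiltonianOp_pencil a b).mono ?_⟩
  · rintro ω X ⟨C, hC, h⟩
    obtain ⟨Θ, hΘ, rfl⟩ := h.exists_potential hC
    exact ⟨Θ, hΘ, by simp [pencil]⟩
  · rintro ω X ⟨X₁, X₂, ⟨C, hC, h⟩, rfl, rfl⟩
    obtain ⟨Θ, hΘ, rfl⟩ := h.exists_potential hC
    exact ⟨Θ, hΘ, rfl⟩

/-! ### The hierarchy and its potentials -/

/-- The vectors `h⁽ᵏ⁾` together with the normalized potentials `D_x⁻¹(v̄ ∧† h⁽ᵏ⁾)`, which satisfy a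
purely algebraic recursion. -/
def hierarchyPair : ℕ → DVec m × Matrix (Fin m) (Fin m) (DiffPoly m)
  | 0 => (dv 0, 0)
  | k + 1 =>
    (Complex.I • (vDx (hierarchyPair k).1 + dv 0 ᵥ* addTrace (hierarchyPair k).2),
      Complex.I • ∑ i : Fin (k + 1),
        (vecMulVec (vconj (hierarchyPair i).1) (hierarchyPair (k - i)).1 -
          (hierarchyPair i).2.trace • (hierarchyPair (k - i)).2))
  decreasing_by all_goals omega

/-- The vectors `h⁽ᵏ⁾` of the hierarchy. -/
def hvec (k : ℕ) : DVec m := (hierarchyPair k).1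

/-- The matrices `D_x⁻¹(v̄ ∧† h⁽ᵏ⁾)`. -/
def pot (k : ℕ) : Matrix (Fin m) (Fin m) (DiffPoly m) := (hierarchyPair k).2

lemma hvec_zero : hvec 0 = (dv 0 : DVec m) := by rw [hvec, hierarchyPair]

lemma pot_zero : pot 0 = (0 : Matrix (Fin m) (Fin m) (DiffPoly m)) := by rw [pot, hierarchyPair]

lemma hvec_succ (k : ℕ) :
    hvec (k + 1) = Complex.I • (vDx (hvec k) + dv 0 ᵥ* addTrace (pot (m := m) k)) := by
  rw [hvec, hierarchyPair, ← hvec, ← pot]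

/-- This convolution is the rank one condition on `laxPi`, order by order in ε. It involves no
integration, so locality is automatic; what must be proved is that it solves the differential
equation (`Dx_pot`). -/
lemma pot_succ (k : ℕ) (a b : Fin m) :
    pot (k + 1) a b = Complex.I • ∑ p ∈ Finset.HasAntidiagonal.antidiagonal k,
      (conj (hvec p.1 a) * hvec p.2 b - (pot p.1).trace * pot p.2 a b) := by
  rw [pot, hierarchyPair]
  dsimp only
  rw [Matrix.smul_apply, Matrix.sum_apply,
    Finset.Nat.sum_antidiagonal_eq_sum_range_succ
      (fun i j => conj (hvec i a) * hvec j b - (pot i).trace * pot j a b), Finset.sum_range]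
  rfl

lemma isAntiHerm_pot (k : ℕ) : IsAntiHerm (pot (m := m) k) := by
  induction k using Nat.strong_induction_on with
  | _ k ih =>
    cases k with
    | zero => intro a b; simp [pot_zero]
    | succ k =>
      intro a b
      have h1 : ∑ p ∈ Finset.HasAntidiagonal.antidiagonal k,
          conj ((pot p.1).trace * pot p.2 a b) =
          ∑ p ∈ Finset.HasAntidiagonal.antidiagonal k, (pot p.1).trace * pot p.2 b a := by
        refine Finset.sum_congr rfl fun p hp => ?_
        have hp' := Finset.HasAntidiagonal.mem_antidiagonal.mp hp
        rw [map_mul, (ih p.1 (by omega)).trace, ih p.2 (by omega) a b, neg_mul_neg]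
      have h2 : ∑ p ∈ Finset.HasAntidiagonal.antidiagonal k,
          conj (conj (hvec p.1 a) * hvec p.2 b) =
          ∑ p ∈ Finset.HasAntidiagonal.antidiagonal k, conj (hvec p.1 b) * hvec p.2 a := by
        rw [← Finset.Nat.sum_antidiagonal_swap]
        refine Finset.sum_congr rfl fun p _ => ?_
        rw [map_mul, conj_conj, mul_comm, Prod.fst_swap, Prod.snd_swap]
      rw [pot_succ, pot_succ, conj_smul, Finset.sum_sub_distrib, Finset.sum_sub_distrib, map_sub,
        map_sum, map_sum, h1, h2, Complex.star_def, Complex.conj_I, neg_smul]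

lemma constantCoeff_hvec (k : ℕ) (a : Fin m) :
    MvPolynomial.constantCoeff (hvec k a) = 0 := by
  cases k with
  | zero => simp [hvec_zero, dv]
  | succ k =>
    rw [hvec_succ, Pi.smul_apply, MvPolynomial.constantCoeff_smul]
    simp [vDx, constantCoeff_Dx, Matrix.vecMul, dotProduct, dv]

lemma constantCoeff_pot (k : ℕ) (a b : Fin m) :
    MvPolynomial.constantCoeff (pot k a b) = 0 := by
  induction k using Nat.strong_induction_on with
  | _ k ih =>
    cases k with
    | zero => simp [pot_zero]
    | succ k =>
      rw [pot_succ, MvPolynomial.constantCoeff_smul, map_sum, Finset.sum_eq_zero, smul_zero]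
      intro p hp
      have : p.2 < k + 1 := by have := Finset.HasAntidiagonal.mem_antidiagonal.mp hp; omega
      rw [map_sub, map_mul, map_mul, constantCoeff_hvec, ih _ this, mul_zero, mul_zero, sub_zero]

/-! ### Generating functions -/

/-- Formal power series with differential polynomials as coefficients. -/
abbrev Series (m : ℕ) : Type := PowerSeries (DiffPoly m)

/-- Coefficientwise application of a derivation. -/
def seriesDeriv (d : Derivation ℂ (DiffPoly m) (DiffPoly m)) :
    Derivation ℂ (Series m) (Series m) :=
  Derivation.mk'
    { toFun := fun f => PowerSeries.mk fun n => d (PowerSeries.coeff n f)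
      map_add' := fun f g => by ext1 n; simp
      map_smul' := fun c f => by ext1 n; simp }
    fun f g => by
      ext1 n
      simp only [LinearMap.coe_mk, AddHom.coe_mk, PowerSeries.coeff_mk, PowerSeries.coeff_mul,
        map_sum, derivation_mul, smul_eq_mul, map_add, Finset.sum_add_distrib]
      rw [add_comm, ← Finset.Nat.sum_antidiagonal_swap (n := n) (f := fun p =>
        PowerSeries.coeff p.1 g * d (PowerSeries.coeff p.2 f))]
      simp only [Prod.fst_swap, Prod.snd_swap, mul_comm]

@[simp] lemma coeff_seriesDeriv (d : Derivation ℂ (DiffPoly m) (DiffPoly m)) (f : Series m)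
    (n : ℕ) : PowerSeries.coeff n (seriesDeriv d f) = d (PowerSeries.coeff n f) := by
  simp [seriesDeriv]

@[simp] lemma seriesDeriv_X (d : Derivation ℂ (DiffPoly m) (DiffPoly m)) :
    seriesDeriv d PowerSeries.X = 0 := by
  ext1 n
  rw [coeff_seriesDeriv, PowerSeries.coeff_X]
  split_ifs <;> simp

@[simp] lemma seriesDeriv_C (d : Derivation ℂ (DiffPoly m) (DiffPoly m)) (f : DiffPoly m) :
    seriesDeriv d (PowerSeries.C f) = PowerSeries.C (d f) := by
  ext1 n
  rw [coeff_seriesDeriv, PowerSeries.coeff_C, PowerSeries.coeff_C]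
  split_ifs <;> simp

/-- The generating function of `h⁽ᵏ⁾`. -/
def hSer (a : Fin m) : Series m := PowerSeries.mk fun k => hvec k a

/-- The generating function of the conjugates of `h⁽ᵏ⁾`. -/
def hbarSer (a : Fin m) : Series m := PowerSeries.mk fun k => conj (hvec k a)

/-- The generating function of the potentials. -/
def potSer : Matrix (Fin m) (Fin m) (Series m) := of fun a b => PowerSeries.mk fun k => pot k a b

/-- The imaginary unit as a constant series. -/
def iSer : Series m := algebraMap ℂ _ Complex.I

lemma iSer_mul_iSer : (iSer : Series m) * iSer = -1 := by
  rw [iSer, ← map_mul, Complex.I_mul_I, map_neg, map_one]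

lemma iSer_mul (f : Series m) : iSer * f = Complex.I • f := by
  rw [iSer, Algebra.smul_def]

@[simp] lemma derivation_iSer (d : Derivation ℂ (Series m) (Series m)) : d iSer = 0 :=
  d.map_algebraMap _

lemma coeff_trace_potSer (k : ℕ) :
    PowerSeries.coeff k (potSer (m := m)).trace = (pot k).trace := by
  simp [Matrix.trace, potSer]

lemma coeff_potSer (k : ℕ) (a b : Fin m) : PowerSeries.coeff k (potSer a b) = pot k a b := by
  simp [potSer]

lemma coeff_complex_smul (c : ℂ) (f : Series m) (n : ℕ) :
    PowerSeries.coeff n (c • f) = c • PowerSeries.coeff n f :=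
  LinearMap.map_smul_of_tower _ c f

lemma hSer_eq (b : Fin m) :
    hSer b = PowerSeries.C (dv 0 b) + PowerSeries.X * iSer * (seriesDeriv Dx (hSer b) +
      potSer.trace * PowerSeries.C (dv 0 b) +
      ∑ a, PowerSeries.C (dv 0 a) * potSer a b) := by
  ext1 n
  rw [mul_assoc, iSer_mul, map_add]
  cases n with
  | zero => simp [hSer, hvec_zero]
  | succ n =>
    rw [PowerSeries.coeff_succ_X_mul, PowerSeries.coeff_C, if_neg n.succ_ne_zero, zero_add,
      coeff_complex_smul]
    simp only [hSer, PowerSeries.coeff_mk, hvec_succ, Pi.smul_apply, map_add, Pi.add_apply,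
      coeff_seriesDeriv, PowerSeries.coeff_mul_C, coeff_trace_potSer, map_sum,
      PowerSeries.coeff_C_mul, addTrace, Matrix.vecMul_add, Matrix.vecMul_smul, Matrix.vecMul_one,
      smul_eq_mul, vDx, Matrix.vecMul, dotProduct, coeff_potSer]
    rw [add_assoc, add_comm (∑ a, _)]

/-- The conjugate of `hSer_eq` with ε treated as real; anti-Hermiticity of the potentials transposes
them and changes their sign. -/
lemma hbarSer_eq (b : Fin m) :
    hbarSer b = PowerSeries.C (dvbar 0 b) - PowerSeries.X * iSer * (seriesDeriv Dx (hbarSer b) -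
      potSer.trace * PowerSeries.C (dvbar 0 b) -
      ∑ a, potSer b a * PowerSeries.C (dvbar 0 a)) := by
  have h0 : ∀ a : Fin m, conj (dv 0 a) = dvbar 0 a := fun a => congrFun (vconj_dv 0) a
  ext1 n
  rw [mul_assoc, iSer_mul, map_sub]
  cases n with
  | zero => simp [hbarSer, hvec_zero, h0]
  | succ n =>
    rw [PowerSeries.coeff_succ_X_mul, PowerSeries.coeff_C, if_neg n.succ_ne_zero, zero_sub,
      coeff_complex_smul]
    simp only [hbarSer, PowerSeries.coeff_mk, hvec_succ, Pi.smul_apply, map_sub, Pi.add_apply,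
      coeff_seriesDeriv, PowerSeries.coeff_mul_C, coeff_trace_potSer, map_sum,
      addTrace, Matrix.vecMul_add, Matrix.vecMul_smul, Matrix.vecMul_one,
      smul_eq_mul, vDx, Matrix.vecMul, dotProduct, coeff_potSer, conj_smul, map_add, map_mul,
      isAntiHerm_pot n _ _, (isAntiHerm_pot n).trace, h0, conj_Dx, Complex.star_def,
      Complex.conj_I, neg_mul, Finset.sum_neg_distrib, mul_comm (dvbar 0 _)]
    rw [neg_smul]
    congr 2
    ring

lemma potSer_eq (a b : Fin m) :
    potSer a b = PowerSeries.X * iSer * (hbarSer a * hSer b - potSer.trace * potSer a b) := by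
  ext1 n
  rw [mul_assoc, iSer_mul]
  cases n with
  | zero => simp [potSer, pot_zero]
  | succ n =>
    rw [PowerSeries.coeff_succ_X_mul, coeff_complex_smul]
    simp only [map_sub, PowerSeries.coeff_mul, coeff_trace_potSer]
    simp only [potSer, hbarSer, hSer, of_apply, PowerSeries.coeff_mk, pot_succ,
      Finset.sum_sub_distrib]

/-! ### The projector solving the stationary Lax equation -/

lemma iSer_eq_C : (iSer : Series m) = PowerSeries.C (MvPolynomial.C Complex.I) := by
  rw [iSer, PowerSeries.algebraMap_apply, MvPolynomial.algebraMap_eq]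

/-- The generating matrix of the hierarchy, a projector of rank one. -/
def laxPi : Matrix (Unit ⊕ Fin m) (Unit ⊕ Fin m) (Series m) :=
  fromBlocks (of fun _ _ => 1 + PowerSeries.X * iSer * potSer.trace)
    (of fun _ b => -(PowerSeries.X * iSer * hSer b))
    (of fun a _ => PowerSeries.X * iSer * hbarSer a)
    (of fun a b => -(PowerSeries.X * iSer * potSer a b))

/-- The constant part of the Lax matrix. -/
def laxJ : Matrix (Unit ⊕ Fin m) (Unit ⊕ Fin m) (DiffPoly m) :=
  fromBlocks (of fun _ _ => -MvPolynomial.C Complex.I) 0 0 0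

/-- The off-diagonal matrix with rows `x` and columns `y`. -/
def laxQ (x y : DVec m) : Matrix (Unit ⊕ Fin m) (Unit ⊕ Fin m) (DiffPoly m) :=
  fromBlocks 0 (of fun _ b => -x b) (of fun a _ => y a) 0

/-- The Lax matrix `J + ε Q`. -/
def laxL : Matrix (Unit ⊕ Fin m) (Unit ⊕ Fin m) (Series m) :=
  laxJ.map PowerSeries.C + (PowerSeries.X : Series m) • (laxQ (dv 0) (dvbar 0)).map PowerSeries.C

lemma laxL_inl_inl (u v : Unit) : laxL (m := m) (Sum.inl u) (Sum.inl v) = -iSer := by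
  simp [laxL, laxJ, laxQ, iSer_eq_C]

lemma laxL_inl_inr (u : Unit) (b : Fin m) :
    laxL (Sum.inl u) (Sum.inr b) = -(PowerSeries.X * PowerSeries.C (dv 0 b)) := by
  simp [laxL, laxJ, laxQ]

lemma laxL_inr_inl (a : Fin m) (u : Unit) :
    laxL (Sum.inr a) (Sum.inl u) = PowerSeries.X * PowerSeries.C (dvbar 0 a) := by
  simp [laxL, laxJ, laxQ]

lemma laxL_inr_inr (a b : Fin m) : laxL (Sum.inr a) (Sum.inr b) = 0 := by
  simp [laxL, laxJ, laxQ]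

/-- The minors through the corner entry vanish: in the lower right block this is `potSer_eq`. The
corner has constant term 1, hence is nonzero in a domain, and cancelling it gives all other minors.
-/
lemma laxPi_rank_one (p q r s : Unit ⊕ Fin m) :
    laxPi p q * laxPi r s = laxPi p s * laxPi r q := by
  have h0 : laxPi (m := m) (Sum.inl ()) (Sum.inl ()) ≠ 0 := by
    intro h
    have := congrArg PowerSeries.constantCoeff h
    simp [laxPi] at this
  have h1 : ∀ p q, laxPi (m := m) p q * laxPi (Sum.inl ()) (Sum.inl ()) =
      laxPi p (Sum.inl ()) * laxPi (Sum.inl ()) q := by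
    rintro (⟨⟩ | a) (⟨⟩ | b)
    · rfl
    · exact mul_comm _ _
    · rfl
    · simp only [laxPi, fromBlocks_apply₁₁, fromBlocks_apply₁₂, fromBlocks_apply₂₁,
        fromBlocks_apply₂₂, of_apply]
      linear_combination -(PowerSeries.X * iSer) * potSer_eq a b
  apply mul_right_cancel₀ (mul_ne_zero h0 h0)
  calc _ = (laxPi p q * laxPi (Sum.inl ()) (Sum.inl ())) *
        (laxPi r s * laxPi (Sum.inl ()) (Sum.inl ())) := by ring
    _ = (laxPi p s * laxPi (Sum.inl ()) (Sum.inl ())) *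
        (laxPi r q * laxPi (Sum.inl ()) (Sum.inl ())) := by rw [h1, h1, h1, h1]; ring
    _ = _ := by ring

lemma trace_laxPi : (laxPi (m := m)).trace = 1 := by
  simp only [Matrix.trace, Fintype.sum_sum_type, laxPi, Matrix.diag, fromBlocks_apply₁₁,
    fromBlocks_apply₂₂, of_apply, Finset.sum_neg_distrib, ← Finset.mul_sum]
  simp

lemma laxPi_mul_mul (N : Matrix (Unit ⊕ Fin m) (Unit ⊕ Fin m) (Series m)) :
    laxPi * N * laxPi = (laxPi * N).trace • laxPi := by
  ext1 p s
  rw [Matrix.smul_apply, smul_eq_mul, Matrix.trace, Finset.sum_mul, Matrix.mul_apply]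
  simp only [Matrix.mul_apply, Matrix.diag, Finset.sum_mul]
  refine Finset.sum_congr rfl fun r _ => Finset.sum_congr rfl fun q _ => ?_
  linear_combination N q r * laxPi_rank_one p q r s

lemma laxPi_mul_self : laxPi (m := m) * laxPi = laxPi := by
  have := laxPi_mul_mul (m := m) 1
  rwa [Matrix.mul_one, trace_laxPi, one_smul] at this

/-- A matrix of power series with `M = M (ε B) + (ε B) M` vanishes. -/
lemma eq_zero_of_eq_X_mul {R n : Type*} [CommRing R] [Fintype n]
    {M B : Matrix n n (PowerSeries R)}
    (h : M = (PowerSeries.X : PowerSeries R) • (M * B + B * M)) : M = 0 := by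
  have key : ∀ k : ℕ, ∀ i j, PowerSeries.coeff k (M i j) = 0 := by
    intro k
    induction k using Nat.strong_induction_on with
    | _ k ih =>
      intro i j
      rw [h]
      cases k with
      | zero => simp
      | succ k =>
        rw [Matrix.smul_apply, smul_eq_mul, PowerSeries.coeff_succ_X_mul, Matrix.add_apply,
          Matrix.mul_apply, Matrix.mul_apply, map_add, map_sum, map_sum, Finset.sum_eq_zero,
          Finset.sum_eq_zero, add_zero]
        · intro l _
          rw [PowerSeries.coeff_mul]
          refine Finset.sum_eq_zero fun p hp => ?_
          have := Finset.HasAntidiagonal.mem_antidiagonal.mp hp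
          rw [ih p.2 (by omega), mul_zero]
        · intro l _
          rw [PowerSeries.coeff_mul]
          refine Finset.sum_eq_zero fun p hp => ?_
          have := Finset.HasAntidiagonal.mem_antidiagonal.mp hp
          rw [ih p.1 (by omega), zero_mul]
  ext i j k
  exact key k i j

/-- The defect of the stationary Lax equation. -/
def laxDefect : Matrix (Unit ⊕ Fin m) (Unit ⊕ Fin m) (Series m) :=
  (PowerSeries.X : Series m) • laxPi.map (seriesDeriv Dx) - (laxL * laxPi - laxPi * laxL)

lemma laxDefect_apply (p q : Unit ⊕ Fin m) : laxDefect p q =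
    PowerSeries.X * seriesDeriv Dx (laxPi p q) -
      ((laxL p (Sum.inl ()) * laxPi (Sum.inl ()) q + ∑ c, laxL p (Sum.inr c) * laxPi (Sum.inr c) q) -
      (laxPi p (Sum.inl ()) * laxL (Sum.inl ()) q +
        ∑ c, laxPi p (Sum.inr c) * laxL (Sum.inr c) q)) := by
  simp [laxDefect, Matrix.mul_apply]

/-- The off-diagonal blocks of the Lax equation are the recursions `hSer_eq` and, in the other
corner, `hbarSer_eq`. -/
lemma laxDefect_inl_inr (b : Fin m) : laxDefect (Sum.inl ()) (Sum.inr b) = 0 := by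
  have hs : ∑ c, laxL (Sum.inl ()) (Sum.inr c) * laxPi (Sum.inr c) (Sum.inr b) =
      PowerSeries.X * PowerSeries.X * iSer *
        ∑ c, PowerSeries.C (dv 0 c) * potSer (m := m) c b := by
    rw [Finset.mul_sum]
    refine Finset.sum_congr rfl fun c _ => ?_
    rw [laxL_inl_inr, laxPi, fromBlocks_apply₂₂, of_apply]
    ring
  rw [laxDefect_apply, hs]
  simp only [laxL_inr_inr, laxL_inl_inl, laxL_inl_inr, mul_zero, Finset.sum_const_zero]
  simp only [laxPi, fromBlocks_apply₁₁, fromBlocks_apply₁₂, of_apply, map_neg,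
    Derivation.leibniz, derivation_iSer, seriesDeriv_X, smul_eq_mul]
  linear_combination PowerSeries.X * hSer_eq b - PowerSeries.X * hSer b * iSer_mul_iSer (m := m)

lemma laxDefect_inr_inl (a : Fin m) : laxDefect (Sum.inr a) (Sum.inl ()) = 0 := by
  have hs : ∑ c, laxPi (Sum.inr a) (Sum.inr c) * laxL (Sum.inr c) (Sum.inl ()) =
      -(PowerSeries.X * PowerSeries.X * iSer *
        ∑ c, potSer (m := m) a c * PowerSeries.C (dvbar 0 c)) := by
    rw [Finset.mul_sum, ← Finset.sum_neg_distrib]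
    refine Finset.sum_congr rfl fun c _ => ?_
    rw [laxL_inr_inl, laxPi, fromBlocks_apply₂₂, of_apply]
    ring
  rw [laxDefect_apply, hs]
  simp only [laxL_inr_inr, laxL_inl_inl, laxL_inr_inl, zero_mul, Finset.sum_const_zero]
  simp only [laxPi, fromBlocks_apply₁₁, fromBlocks_apply₂₁, of_apply,
    Derivation.leibniz, derivation_iSer, seriesDeriv_X, smul_eq_mul]
  linear_combination PowerSeries.X * hbarSer_eq a - PowerSeries.X * hbarSer a * iSer_mul_iSer (m := m)

lemma trace_laxDefect : (laxDefect (m := m)).trace = 0 := by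
  rw [laxDefect, Matrix.trace_sub, Matrix.trace_sub, Matrix.trace_mul_comm, sub_self, sub_zero,
    Matrix.trace_smul, ← derivation_trace, trace_laxPi]
  simp

/-- Both ε D_x and the commutator with L are derivations, so their difference applied to Π = Π²
obeys the Leibniz rule. -/
lemma laxDefect_eq : laxDefect (m := m) = laxDefect * laxPi + laxPi * laxDefect := by
  have hd : laxPi.map (seriesDeriv Dx) = laxPi.map (seriesDeriv Dx) * laxPi +
      laxPi (m := m) * laxPi.map (seriesDeriv Dx) := by
    rw [← map_derivation_mul, laxPi_mul_self]
  have hc : laxL * laxPi - laxPi * laxL = (laxL * laxPi - laxPi * laxL) * laxPi +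
      laxPi (m := m) * (laxL * laxPi - laxPi * laxL) := by
    rw [Matrix.sub_mul, Matrix.mul_sub, Matrix.mul_assoc, laxPi_mul_self, ← Matrix.mul_assoc laxPi laxPi,
      laxPi_mul_self, Matrix.mul_assoc]
    abel
  rw [laxDefect, Matrix.sub_mul, Matrix.mul_sub, Matrix.smul_mul, Matrix.mul_smul]
  conv_lhs => rw [hd, hc]
  rw [smul_add]
  abel

lemma laxDefect_inr_inr (a b : Fin m) : laxDefect (Sum.inr a) (Sum.inr b) = 0 := by
  have h : (laxDefect (m := m)).toBlocks₂₂ = 0 := by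
    -- As the off-diagonal defect vanishes, the lower right block E satisfies E = E Π₂₂ + Π₂₂ E.
    -- Here Π₂₂ is divisible by ε, so E vanishes to every order. The corner entry then follows from
    -- the trace.
    refine eq_zero_of_eq_X_mul (B := of fun a b => -(iSer * potSer (m := m) a b)) ?_
    ext1 a b
    have := congrFun (congrFun (laxDefect_eq (m := m)) (Sum.inr a)) (Sum.inr b)
    rw [toBlocks₂₂, of_apply, this]
    simp only [Matrix.add_apply, Matrix.mul_apply, Fintype.sum_sum_type, Finset.univ_unique,
      Finset.sum_singleton, PUnit.default_eq_unit, laxDefect_inr_inl, laxDefect_inl_inr, zero_mul,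
      mul_zero, zero_add, laxPi, fromBlocks_apply₂₂, of_apply, Matrix.smul_apply,
      smul_eq_mul]
    rw [mul_add, Finset.mul_sum, Finset.mul_sum]
    refine congrArg₂ (· + ·) (Finset.sum_congr rfl fun _ _ => ?_)
      (Finset.sum_congr rfl fun _ _ => ?_) <;> ring
  exact congrFun (congrFun h a) b

/-- The stationary Lax equation. -/
theorem lax_equation : (PowerSeries.X : Series m) • (laxPi (m := m)).map (seriesDeriv Dx) =
    laxL * laxPi - laxPi * laxL := by
  refine sub_eq_zero.mp ?_
  change laxDefect = 0
  have h := trace_laxDefect (m := m)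
  simp only [Matrix.trace, Fintype.sum_sum_type, Matrix.diag, laxDefect_inr_inr] at h
  ext1 p q
  obtain ⟨⟩ | a := p <;> obtain ⟨⟩ | b := q
  · simpa using h
  · exact laxDefect_inl_inr b
  · exact laxDefect_inr_inl a
  · exact laxDefect_inr_inr a b

/-- The matrices `pot k` are inverse derivatives of `v̄ ∧† h⁽ᵏ⁾`. -/
theorem Dx_pot (k : ℕ) : (pot k).map Dx = hwedge (dvbar 0) (hvec (m := m) k) := by
  ext1 a b
  have h := laxDefect_inr_inr a b
  rw [laxDefect_apply] at h
  simp only [laxL_inr_inr, laxL_inl_inr, laxL_inr_inl, zero_mul, mul_zero,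
    Finset.sum_const_zero] at h
  simp only [laxPi, fromBlocks_apply₁₂, fromBlocks_apply₂₁, fromBlocks_apply₂₂, of_apply,
    Derivation.leibniz, derivation_iSer, seriesDeriv_X, smul_eq_mul, map_neg] at h
  have hX : (PowerSeries.X : Series m) * PowerSeries.X * iSer ≠ 0 :=
    mul_ne_zero (mul_ne_zero PowerSeries.X_ne_zero PowerSeries.X_ne_zero) fun h0 => by
      simpa [h0] using iSer_mul_iSer (m := m)
  have h2 : seriesDeriv Dx (potSer a b) =
      PowerSeries.C (dvbar 0 a) * hSer b - hbarSer a * PowerSeries.C (dv 0 b) :=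
    mul_left_cancel₀ hX (by linear_combination -h)
  have h3 := congrArg (PowerSeries.coeff k) h2
  rw [map_sub, coeff_seriesDeriv, PowerSeries.coeff_C_mul, PowerSeries.coeff_mul_C,
    coeff_potSer] at h3
  rw [Matrix.map_apply, h3]
  simp [hSer, hbarSer, hwedge, vecMulVec_apply, vconj_dvbar, vconj]

/-! ### The trace identity -/

/-- If D P = [L, P] and D P₁, D P₂ are its linearizations with L varied by A and B, the left side is
the trace of D(P[P₁, P₂]). All terms in L form a commutator and drop out. The rest simplifies
because P M P = 0 for M tangent to the projectors. -/
lemma trace_variation {R n : Type*} [CommRing R] [Fintype n] {P P₁ P₂ : Matrix n n R}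
    (L A B : Matrix n n R) (hP : P * P = P) (h₁ : P₁ = P₁ * P + P * P₁)
    (h₂ : P₂ = P₂ * P + P * P₂) :
    ((L * P - P * L) * (P₁ * P₂ - P₂ * P₁) +
      P * (((A * P - P * A) + (L * P₁ - P₁ * L)) * P₂ + P₁ * ((B * P - P * B) + (L * P₂ - P₂ * L)) -
        (((B * P - P * B) + (L * P₂ - P₂ * L)) * P₁ +
          P₂ * ((A * P - P * A) + (L * P₁ - P₁ * L))))).trace =
      (B * P₁).trace - (A * P₂).trace := by
  have z : ∀ {M : Matrix n n R}, M = M * P + P * M → P * M * P = 0 := by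
    intro M hM
    have := congrArg (fun N => P * N) hM
    simp only [Matrix.mul_add, ← Matrix.mul_assoc, hP] at this
    simpa using this
  have s : ∀ M : Matrix n n R, (M * P).trace = (P * M).trace := fun M => Matrix.trace_mul_comm M P
  have e : (L * P - P * L) * (P₁ * P₂ - P₂ * P₁) +
      P * (((A * P - P * A) + (L * P₁ - P₁ * L)) * P₂ + P₁ * ((B * P - P * B) + (L * P₂ - P₂ * L)) -
        (((B * P - P * B) + (L * P₂ - P₂ * L)) * P₁ +
          P₂ * ((A * P - P * A) + (L * P₁ - P₁ * L)))) =
      (L * (P * (P₁ * P₂ - P₂ * P₁)) - (P * (P₁ * P₂ - P₂ * P₁)) * L) +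
      ((P * A) * (P * P₂) - (P * P) * (A * P₂) + P * P₁ * B * P - (P * P₁ * P) * B
        - (P * B) * (P * P₁) + (P * P) * (B * P₁) - P * P₂ * A * P + (P * P₂ * P) * A) := by
    noncomm_ring
  have k : ∀ {M N : Matrix n n R}, M = M * P + P * M → ((P * N) * (P * M)).trace = 0 := by
    intro M N hM
    rw [Matrix.mul_assoc P N, Matrix.trace_mul_comm, Matrix.mul_assoc N, z hM, Matrix.mul_zero,
      Matrix.trace_zero]
  have f : ∀ {M : Matrix n n R} (N : Matrix n n R), M = M * P + P * M →
      (P * (N * M)).trace + (P * M * N * P).trace = (N * M).trace := by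
    intro M N hM
    conv_rhs => rw [hM]
    rw [Matrix.mul_add, Matrix.trace_add, ← Matrix.mul_assoc N M, s (N * M), s (P * M * N),
      Matrix.mul_assoc P M N, ← Matrix.mul_assoc P P, hP, ← Matrix.mul_assoc P M,
      Matrix.trace_mul_comm (P * M)]
  rw [e, Matrix.trace_add, Matrix.trace_sub, Matrix.trace_mul_comm L, sub_self, zero_add, z h₁, z h₂,
    hP, ← f B h₁, ← f A h₂]
  simp only [Matrix.trace_add, Matrix.trace_sub, k h₁, k h₂, Matrix.zero_mul, Matrix.trace_zero]
  ring

/-- The Euler operator `ε d/dε` on power series. -/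
def eulerDeriv : Derivation ℂ (Series m) (Series m) :=
  (PowerSeries.X : Series m) • (PowerSeries.derivative (DiffPoly m)).restrictScalars ℂ

lemma eulerDeriv_apply (f : Series m) :
    eulerDeriv f = PowerSeries.X * PowerSeries.derivative (DiffPoly m) f := rfl

lemma coeff_eulerDeriv (f : Series m) (n : ℕ) :
    PowerSeries.coeff n (eulerDeriv f) = n * PowerSeries.coeff n f := by
  rw [eulerDeriv_apply]
  cases n with
  | zero => simp
  | succ n => rw [PowerSeries.coeff_succ_X_mul, PowerSeries.coeff_derivative]; push_cast; ring

lemma eulerDeriv_C (f : DiffPoly m) : eulerDeriv (PowerSeries.C f) = 0 := by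
  rw [eulerDeriv_apply, PowerSeries.derivative_C, mul_zero]

lemma eulerDeriv_X : eulerDeriv (PowerSeries.X : Series m) = PowerSeries.X := by
  rw [eulerDeriv_apply, PowerSeries.derivative_X, mul_one]

lemma seriesDeriv_eulerDeriv (d : Derivation ℂ (DiffPoly m) (DiffPoly m)) (f : Series m) :
    seriesDeriv d (eulerDeriv f) = eulerDeriv (seriesDeriv d f) := by
  ext1 n
  rw [coeff_seriesDeriv, coeff_eulerDeriv, coeff_eulerDeriv, coeff_seriesDeriv, derivation_mul,
    Derivation.map_natCast, zero_mul, zero_add]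

lemma seriesDeriv_comm {d e : Derivation ℂ (DiffPoly m) (DiffPoly m)} (h : ∀ f, d (e f) = e (d f))
    (f : Series m) : seriesDeriv d (seriesDeriv e f) = seriesDeriv e (seriesDeriv d f) := by
  ext1 n
  simp [h]

lemma map_derivation_smul {A n k : Type*} [CommRing A] [Algebra ℂ A] (d : Derivation ℂ A A)
    (a : A) (M : Matrix n k A) : (a • M).map d = d a • M + a • M.map d := by
  ext i j
  simp only [Matrix.map_apply, Matrix.smul_apply, Matrix.add_apply, smul_eq_mul, Derivation.leibniz]
  ring

lemma map_derivation_add {A n k : Type*} [CommRing A] [Algebra ℂ A] (d : Derivation ℂ A A)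
    (M N : Matrix n k A) : (M + N).map d = M.map d + N.map d :=
  Matrix.map_add d (map_add d) M N

lemma map_derivation_sub {A n k : Type*} [CommRing A] [Algebra ℂ A] (d : Derivation ℂ A A)
    (M N : Matrix n k A) : (M - N).map d = M.map d - N.map d :=
  Matrix.map_sub d (map_sub d) M N

lemma map_derivation_of_mul_self {A n : Type*} [CommRing A] [Algebra ℂ A] [Fintype n]
    (d : Derivation ℂ A A) {P : Matrix n n A} (hP : P * P = P) :
    P.map d = P.map d * P + P * P.map d := by
  rw [← map_derivation_mul, hP]

lemma map_seriesDeriv_laxL (d : Derivation ℂ (DiffPoly m) (DiffPoly m)) :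
    (laxL (m := m)).map (seriesDeriv d) = (PowerSeries.X : Series m) •
      (laxQ (fun j => d (dv 0 j)) (fun j => d (dvbar 0 j))).map PowerSeries.C := by
  ext1 p q
  obtain u | a := p <;> obtain v | b := q <;>
    simp [laxL_inl_inl, laxL_inl_inr, laxL_inr_inl, laxL_inr_inr, laxQ]

lemma map_eulerDeriv_laxL :
    (laxL (m := m)).map eulerDeriv = laxL - laxJ.map PowerSeries.C := by
  ext1 p q
  obtain u | a := p <;> obtain v | b := q <;>
    simp [laxL_inl_inl, laxL_inl_inr, laxL_inr_inl, laxL_inr_inr, laxJ, eulerDeriv_C,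
      eulerDeriv_X, iSer_eq_C, mul_comm]

lemma lax_equation_variation {d : Derivation ℂ (DiffPoly m) (DiffPoly m)}
    (hd : ∀ f, d (Dx f) = Dx (d f)) :
    (PowerSeries.X : Series m) • (laxPi.map (seriesDeriv d)).map (seriesDeriv Dx) =
      (laxL.map (seriesDeriv d) * laxPi - laxPi * laxL.map (seriesDeriv d)) +
      (laxL * laxPi.map (seriesDeriv d) - laxPi.map (seriesDeriv d) * laxL) := by
  have h := congrArg (fun M => M.map (seriesDeriv d)) (lax_equation (m := m))
  simp only [map_derivation_smul, map_derivation_sub, map_derivation_mul, seriesDeriv_X, zero_smul,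
    zero_add] at h
  have hc : ((laxPi (m := m)).map (seriesDeriv Dx)).map (seriesDeriv d) =
      (laxPi.map (seriesDeriv d)).map (seriesDeriv Dx) :=
    Matrix.ext fun p q => seriesDeriv_comm hd _
  rw [← hc, h]
  abel

/-- Since ε∂_ε L = εQ = L - J, and the factor ε on the left reproduces [L, Π] once more,
differentiation in ε acts as the variation of L by -J. -/
lemma lax_equation_eulerDeriv :
    (PowerSeries.X : Series m) • ((laxPi (m := m)).map eulerDeriv).map (seriesDeriv Dx) =
      ((-laxJ.map PowerSeries.C) * laxPi - laxPi * (-laxJ.map PowerSeries.C)) +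
      (laxL * laxPi.map eulerDeriv - laxPi.map eulerDeriv * laxL) := by
  have h : ((PowerSeries.X : Series m) • (laxPi (m := m)).map (seriesDeriv Dx)).map eulerDeriv =
      (laxL * laxPi - laxPi * laxL).map eulerDeriv := by rw [lax_equation]
  rw [map_derivation_smul, eulerDeriv_X, lax_equation, map_derivation_sub, map_derivation_mul,
    map_derivation_mul, map_eulerDeriv_laxL] at h
  have hc : ((laxPi (m := m)).map (seriesDeriv Dx)).map eulerDeriv =
      (laxPi.map eulerDeriv).map (seriesDeriv Dx) :=
    Matrix.ext fun p q => (seriesDeriv_eulerDeriv Dx _).symm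
  rw [hc, ← eq_sub_iff_add_eq'] at h
  rw [h]
  noncomm_ring

/-- The trace identity. -/
lemma trace_identity {d : Derivation ℂ (DiffPoly m) (DiffPoly m)}
    (hd : ∀ f, d (Dx f) = Dx (d f)) :
    PowerSeries.X * seriesDeriv Dx (laxPi * (laxPi.map (seriesDeriv d) * laxPi.map eulerDeriv -
      laxPi.map eulerDeriv * laxPi.map (seriesDeriv d))).trace =
      -(laxJ.map PowerSeries.C * (laxPi (m := m)).map (seriesDeriv d)).trace -
        (laxL.map (seriesDeriv d) * laxPi.map eulerDeriv).trace := by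
  have h := trace_variation laxL (laxL.map (seriesDeriv d)) (-laxJ.map PowerSeries.C)
    (laxPi_mul_self (m := m)) (map_derivation_of_mul_self (seriesDeriv d) laxPi_mul_self)
    (map_derivation_of_mul_self eulerDeriv laxPi_mul_self)
  rw [Matrix.neg_mul (laxJ.map PowerSeries.C) (laxPi.map (seriesDeriv d)), Matrix.trace_neg] at h
  rw [← h, ← lax_equation, ← lax_equation_variation hd, ← lax_equation_eulerDeriv,
    derivation_trace, ← smul_eq_mul, ← Matrix.trace_smul]
  simp only [map_derivation_sub, map_derivation_mul, smul_add, smul_sub, Matrix.smul_mul,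
    Matrix.mul_smul, Matrix.mul_add, Matrix.mul_sub]
  congr 1
  abel

lemma trace_laxJ_mul (d : Derivation ℂ (DiffPoly m) (DiffPoly m)) :
    (laxJ.map PowerSeries.C * (laxPi (m := m)).map (seriesDeriv d)).trace =
      PowerSeries.X * seriesDeriv d potSer.trace := by
  simp only [Matrix.trace, Matrix.diag, Matrix.mul_apply, Fintype.sum_sum_type, Matrix.map_apply,
    laxJ, laxPi, fromBlocks_apply₁₁, fromBlocks_apply₁₂, fromBlocks_apply₂₁, fromBlocks_apply₂₂,
    of_apply, Matrix.zero_apply, map_zero, zero_mul, Finset.sum_const_zero, add_zero, map_neg,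
    ← iSer_eq_C, Finset.univ_unique, Finset.sum_singleton, map_add, Derivation.leibniz,
    derivation_iSer, seriesDeriv_X, smul_eq_mul, Derivation.map_one_eq_zero]
  linear_combination -(PowerSeries.X * (seriesDeriv d) (∑ x, potSer x x)) * iSer_mul_iSer (m := m)

/-- The derivation varying only `v̄`, in the direction `w`. -/
def barVariation (w : DVec m) : Derivation ℂ (DiffPoly m) (DiffPoly m) :=
  prolong fun b j => if b then w j else 0

lemma barVariation_dv (w : DVec m) (j : Fin m) : barVariation w (dv 0 j) = 0 := by
  simp [barVariation, dv]

lemma barVariation_dvbar (w : DVec m) (j : Fin m) : barVariation w (dvbar 0 j) = w j := by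
  simp [barVariation, dvbar]

lemma trace_laxL_mul (w : DVec m) :
    (laxL.map (seriesDeriv (barVariation w)) * laxPi.map eulerDeriv).trace =
      -(PowerSeries.X * iSer * ∑ a, PowerSeries.C (w a) * eulerDeriv (PowerSeries.X * hSer a)) := by
  rw [map_seriesDeriv_laxL]
  simp only [Matrix.trace, Matrix.diag, Matrix.mul_apply, Fintype.sum_sum_type, Matrix.map_apply,
    laxQ, laxPi, fromBlocks_apply₁₁, fromBlocks_apply₁₂, fromBlocks_apply₂₁, fromBlocks_apply₂₂,
    of_apply, Matrix.zero_apply, map_zero, zero_mul, Finset.sum_const_zero, add_zero, map_neg,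
    Finset.univ_unique, Finset.sum_singleton, Matrix.smul_apply, smul_eq_mul, mul_zero, zero_add,
    barVariation_dv, barVariation_dvbar, neg_zero]
  rw [Finset.mul_sum, ← Finset.sum_neg_distrib]
  refine Finset.sum_congr rfl fun a _ => ?_
  simp only [Derivation.leibniz, derivation_iSer, smul_eq_mul, mul_neg]
  ring

/-- The coefficient of ε^{k+1} in the trace identity, divided by ε. The factor k+1 is the Euler
operator acting on the term h⁽ᵏ⁾ ε^{k+1}. -/
lemma isTotalDeriv_variation_trace (w : DVec m) (k : ℕ) :
    IsTotalDeriv (∑ a, w a * ((Complex.I * (k + 1)) • hvec k a) -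
      barVariation w (pot (k + 1)).trace) := by
  have h := trace_identity (d := barVariation w) fun f => prolong_Dx _ f
  rw [trace_laxJ_mul, trace_laxL_mul] at h
  set S := (laxPi * (laxPi.map (seriesDeriv (barVariation w)) * laxPi.map eulerDeriv -
      laxPi.map eulerDeriv * laxPi.map (seriesDeriv (barVariation w)))).trace with hS
  have h2 : seriesDeriv Dx S = iSer * ∑ a, PowerSeries.C (w a) *
      eulerDeriv (PowerSeries.X * hSer a) - seriesDeriv (barVariation w) potSer.trace :=
    mul_left_cancel₀ PowerSeries.X_ne_zero (by rw [h]; ring)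
  refine ⟨PowerSeries.coeff (k + 1) S, ?_⟩
  have h3 := congrArg (PowerSeries.coeff (k + 1)) h2
  rw [coeff_seriesDeriv, map_sub, coeff_seriesDeriv, coeff_trace_potSer, iSer_mul,
    coeff_complex_smul, map_sum] at h3
  rw [h3, Finset.smul_sum]
  congr 1
  refine Finset.sum_congr rfl fun a _ => ?_
  rw [PowerSeries.coeff_C_mul, coeff_eulerDeriv, PowerSeries.coeff_succ_X_mul, hSer,
    PowerSeries.coeff_mk]
  simp only [MvPolynomial.smul_eq_C_mul, map_mul, map_add, map_natCast, map_one]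
  push_cast
  ring

/-! ### Variational derivatives -/

lemma isTotalDeriv_iterate_Dx_mul (n : ℕ) (w f : DiffPoly m) :
    IsTotalDeriv (Dx^[n] w * f - w * ((-1 : ℂ) ^ n • Dx^[n] f)) := by
  induction n generalizing f with
  | zero => exact ⟨0, by simp⟩
  | succ n ih =>
    obtain ⟨g, hg⟩ := ih (Dx f)
    refine ⟨Dx^[n] w * f - g, ?_⟩
    rw [map_sub, hg, Dx_mul, Function.iterate_succ_apply', Function.iterate_succ_apply, pow_succ,
      mul_neg_one, neg_smul]
    ring

lemma varDeriv_eq_sum {H : DiffPoly m} {M : ℕ}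
    (hM : ∀ j n, M ≤ n → MvPolynomial.pderiv (true, j, n) H = 0) (j : Fin m) :
    varDeriv H j = ∑ n ∈ Finset.range M,
      (-1 : ℂ) ^ n • Dx^[n] (MvPolynomial.pderiv (true, j, n) H) := by
  refine finsum_eq_sum_of_support_subset _ fun n hn => ?_
  by_contra hc
  apply hn
  have : ∀ n : ℕ, Dx^[n] (0 : DiffPoly m) = 0 := fun n =>
    Function.iterate_fixed (map_zero _) n
  simp only [Finset.coe_range, Set.mem_Iio, not_lt] at hc
  simp only [hM j n hc, this, smul_zero]

lemma derivation_sum_apply {ι : Type*} (s : Finset ι)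
    (d : ι → Derivation ℂ (DiffPoly m) (DiffPoly m)) (f : DiffPoly m) :
    (∑ i ∈ s, d i) f = ∑ i ∈ s, d i f := by
  classical
  induction s using Finset.induction_on with
  | empty => simp
  | insert a s ha ih => rw [Finset.sum_insert ha, Finset.sum_insert ha, Derivation.add_apply, ih]

lemma isTotalDeriv_barVariation_sub (w : DVec m) (H : DiffPoly m) :
    IsTotalDeriv (barVariation w H - ∑ j, w j * varDeriv H j) := by
  set M := (H.vars.image fun p => p.2.2).sup id + 1
  have hv : ∀ p ∈ H.vars, p.2.2 < M := fun p hp => by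
    have := Finset.le_sup (f := id) (Finset.mem_image_of_mem (fun p : JetVar m => p.2.2) hp)
    simp only [id] at this
    omega
  have hM : ∀ j n, M ≤ n → MvPolynomial.pderiv (true, j, n) H = 0 := fun j n hn =>
    MvPolynomial.pderiv_eq_zero_of_notMem_vars fun h => by have := hv _ h; simp at this; omega
  -- The sum truncated at order M is not `barVariation w` itself, but both derivations agree on the
  -- variables that occur in H.
  have hd : barVariation w H = (∑ j, ∑ n ∈ Finset.range M,
      (Dx^[n] (w j)) • MvPolynomial.pderiv (R := ℂ) ((true, j, n) : JetVar m)) H := by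
    apply MvPolynomial.derivation_eq_of_forall_mem_vars
    rintro ⟨b, i, k⟩ hp
    have hk := hv _ hp
    rw [barVariation, prolong_X]
    simp only [derivation_sum_apply, Derivation.smul_apply, smul_eq_mul,
      MvPolynomial.pderiv_X, Pi.single_apply, Prod.mk.injEq]
    cases b with
    | false => simp [Function.iterate_fixed (map_zero (Dx (m := m)))]
    | true =>
      rw [Finset.sum_eq_single i, Finset.sum_eq_single k]
      · simp
      · intro n _ hn; simp [hn.symm]
      · intro h; exact absurd (Finset.mem_range.mpr hk) h
      · intro j _ hj; simp [hj.symm]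
      · intro h; exact absurd (Finset.mem_univ i) h
  rw [hd]
  simp only [derivation_sum_apply, Derivation.smul_apply, smul_eq_mul,
    varDeriv_eq_sum hM, Finset.mul_sum]
  rw [← Finset.sum_sub_distrib]
  refine IsTotalDeriv.sum _ fun j _ => ?_
  rw [← Finset.sum_sub_distrib]
  exact IsTotalDeriv.sum _ fun n _ => isTotalDeriv_iterate_Dx_mul n _ _

/-- The first variation determines the gradient: test with w supported in a single component and
apply the fundamental lemma. -/
lemma varDeriv_eq_of_barVariation {H : DiffPoly m} {g : DVec m}
    (h : ∀ w, IsTotalDeriv (∑ a, w a * g a - barVariation w H)) : varDeriv H = g := by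
  ext1 j
  refine (sub_eq_zero.mp (eq_zero_of_forall_isTotalDeriv_mul j fun f => ?_)).symm
  have := (h (Pi.single j f)).add (isTotalDeriv_barVariation_sub (Pi.single j f) H)
  rw [sub_add_sub_cancel, ← Finset.sum_sub_distrib, Finset.sum_eq_single j] at this
  · simpa [mul_sub] using this
  · intro i _ hi; simp [hi]
  · intro hj; exact absurd (Finset.mem_univ j) hj

theorem varDeriv_trace_pot (k : ℕ) :
    varDeriv (pot (k + 1)).trace = (Complex.I * (k + 1)) • hvec (m := m) k :=
  varDeriv_eq_of_barVariation fun w => isTotalDeriv_variation_trace w k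

lemma varDeriv_smul (c : ℂ) (H : DiffPoly m) : varDeriv (c • H) = c • varDeriv H := by
  ext1 j
  obtain ⟨M, hM⟩ := exists_forall_pderiv_eq_zero H
  have hi : ∀ (n : ℕ) (f : DiffPoly m), Dx^[n] (c • f) = c • Dx^[n] f := by
    intro n f
    induction n with
    | zero => rfl
    | succ n ih => rw [Function.iterate_succ_apply', ih, Derivation.map_smul,
        Function.iterate_succ_apply']
  rw [Pi.smul_apply, varDeriv_eq_sum (M := M) fun j n h => hM true j n h,
    varDeriv_eq_sum (M := M) fun j n h => by rw [Derivation.map_smul, hM true j n h, smul_zero],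
    Finset.smul_sum]
  refine Finset.sum_congr rfl fun n _ => ?_
  rw [Derivation.map_smul, hi, smul_comm]

lemma varDeriv_sub (H K : DiffPoly m) : varDeriv (H - K) = varDeriv H - varDeriv K := by
  ext1 j
  obtain ⟨M, hM⟩ := exists_forall_pderiv_eq_zero H
  obtain ⟨M', hM'⟩ := exists_forall_pderiv_eq_zero K
  have hi : ∀ (n : ℕ) (f g : DiffPoly m), Dx^[n] (f - g) = Dx^[n] f - Dx^[n] g :=
    fun n f g => iterate_map_sub Dx n f g
  have h1 : ∀ j n, max M M' ≤ n → MvPolynomial.pderiv (true, j, n) H = 0 :=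
    fun j n h => hM _ _ _ (le_of_max_le_left h)
  have h2 : ∀ j n, max M M' ≤ n → MvPolynomial.pderiv (true, j, n) K = 0 :=
    fun j n h => hM' _ _ _ (le_of_max_le_right h)
  rw [Pi.sub_apply, varDeriv_eq_sum h1, varDeriv_eq_sum h2,
    varDeriv_eq_sum (M := max M M') fun j n h => by rw [map_sub, h1 j n h, h2 j n h, sub_zero],
    ← Finset.sum_sub_distrib]
  refine Finset.sum_congr rfl fun n _ => ?_
  rw [map_sub, hi, smul_sub]

/-! ### The Hamiltonians -/

/-- The Hamiltonian densities of the hierarchy. -/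
def ham (k : ℕ) : DiffPoly m := (Complex.I / (k + 1)) • (pot (k + 1)).trace

lemma conj_ham (k : ℕ) : conj (ham (m := m) k) = ham k := by
  rw [ham, conj_smul, (isAntiHerm_pot _).trace, smul_neg, ← neg_smul]
  congr 1
  simp [neg_div]

lemma varDeriv_ham (k : ℕ) : varDeriv (ham (m := m) k) = -hvec k := by
  have hk : (k : ℂ) + 1 ≠ 0 := Nat.cast_add_one_ne_zero k
  rw [ham, varDeriv_smul, varDeriv_trace_pot, smul_smul, ← neg_one_smul ℂ (hvec k)]
  congr 1
  field_simp
  exact Complex.I_sq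

lemma hvec_one : hvec 1 = (Complex.I • dv 1 : DVec m) := by
  rw [hvec_succ, hvec_zero, pot_zero, vDx_dv]
  simp [addTrace]

lemma pot_one : pot 1 = Complex.I • vecMulVec (dvbar 0) (dv (m := m) 0) := by
  ext1 a b
  rw [pot_succ]
  simp [pot_zero, hvec_zero, vecMulVec_apply, ← vconj_dv, vconj]

lemma pot_two : pot 2 =
    vecMulVec (dvbar 1) (dv 0) - vecMulVec (dvbar 0) (dv (m := m) 1) := by
  have h0 : ∀ n, ∀ a : Fin m, conj (dv n a) = dvbar n a := fun n a => congrFun (vconj_dv n) a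
  ext1 a b
  rw [pot_succ, Finset.Nat.sum_antidiagonal_succ]
  simp [pot_zero, hvec_zero, hvec_one, vecMulVec_apply, h0, conj_smul]
  simp only [smul_smul, Complex.I_mul_I]
  module

lemma ham_zero : ham 0 = -(dv 0 ⬝ᵥ dvbar (m := m) 0) := by
  rw [ham, pot_one, trace_smul, trace_vecMulVec, dotProduct_comm, smul_smul]
  simp

lemma ham_one : ham 1 =
    (Complex.I / 2) • (dv 0 ⬝ᵥ dvbar 1 - dv 1 ⬝ᵥ dvbar (m := m) 0) := by
  rw [ham, pot_two, trace_sub, trace_vecMulVec, trace_vecMulVec, dotProduct_comm,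
    dotProduct_comm (dvbar 0)]
  norm_num

/-! ### Commutation of the flows -/

section

attribute [local instance] LieRing.ofAssociativeRing

/-- The coefficients of the projector `laxPi`. -/
def laxCoeff (l : ℕ) : Matrix (Unit ⊕ Fin m) (Unit ⊕ Fin m) (DiffPoly m) :=
  laxPi.map (PowerSeries.coeff l)

lemma laxCoeff_zero : laxCoeff (m := m) 0 = fromBlocks 1 0 0 0 := by
  ext1 p q
  obtain u | a := p <;> obtain v | b := q <;> simp [laxCoeff, laxPi, mul_assoc]

lemma coeff_X_iSer_mul (f : Series m) (l : ℕ) :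
    PowerSeries.coeff (l + 1) (PowerSeries.X * iSer * f) = Complex.I • PowerSeries.coeff l f := by
  rw [mul_assoc, PowerSeries.coeff_succ_X_mul, iSer_mul, coeff_complex_smul]

lemma laxCoeff_succ_inl_inr (l : ℕ) (u : Unit) (b : Fin m) :
    laxCoeff (l + 1) (Sum.inl u) (Sum.inr b) = -(Complex.I • hvec l b) := by
  rw [laxCoeff, Matrix.map_apply, laxPi, fromBlocks_apply₁₂, of_apply, map_neg, coeff_X_iSer_mul,
    hSer, PowerSeries.coeff_mk]

lemma laxCoeff_succ_inr_inl (l : ℕ) (a : Fin m) (u : Unit) :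
    laxCoeff (l + 1) (Sum.inr a) (Sum.inl u) = Complex.I • conj (hvec l a) := by
  rw [laxCoeff, Matrix.map_apply, laxPi, fromBlocks_apply₂₁, of_apply, coeff_X_iSer_mul,
    hbarSer, PowerSeries.coeff_mk]

lemma laxCoeff_succ_inl_inl (l : ℕ) (u v : Unit) :
    laxCoeff (l + 1) (Sum.inl u) (Sum.inl v) = Complex.I • (pot (m := m) l).trace := by
  rw [laxCoeff, Matrix.map_apply, laxPi, fromBlocks_apply₁₁, of_apply, map_add, coeff_X_iSer_mul,
    coeff_trace_potSer, PowerSeries.coeff_one, if_neg l.succ_ne_zero, zero_add]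

lemma laxCoeff_succ_inr_inr (l : ℕ) (a b : Fin m) :
    laxCoeff (l + 1) (Sum.inr a) (Sum.inr b) = -(Complex.I • pot l a b) := by
  rw [laxCoeff, Matrix.map_apply, laxPi, fromBlocks_apply₂₂, of_apply, map_neg, coeff_X_iSer_mul,
    coeff_potSer]

lemma constantCoeff_laxCoeff_succ (l : ℕ) :
    (laxCoeff (m := m) (l + 1)).map MvPolynomial.constantCoeff = 0 := by
  ext1 p q
  obtain u | a := p <;> obtain v | b := q <;>
    simp [laxCoeff_succ_inl_inl, laxCoeff_succ_inl_inr, laxCoeff_succ_inr_inl,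
      laxCoeff_succ_inr_inr, constantCoeff_hvec, constantCoeff_pot, constantCoeff_conj,
      Matrix.trace]

lemma map_coeff_C_mul {n : Type*} [Fintype n] (M : Matrix n n (DiffPoly m))
    (N : Matrix n n (Series m)) (l : ℕ) :
    (M.map PowerSeries.C * N).map (PowerSeries.coeff l) = M * N.map (PowerSeries.coeff l) := by
  ext1 i j
  simp [Matrix.mul_apply]

lemma map_coeff_mul_C {n : Type*} [Fintype n] (M : Matrix n n (DiffPoly m))
    (N : Matrix n n (Series m)) (l : ℕ) :
    (N * M.map PowerSeries.C).map (PowerSeries.coeff l) = N.map (PowerSeries.coeff l) * M := by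
  ext1 i j
  simp [Matrix.mul_apply]

lemma map_Dx_laxCoeff (l : ℕ) :
    (laxCoeff (m := m) l).map Dx =
      ⁅laxJ (m := m), laxCoeff (l + 1)⁆ + ⁅laxQ (m := m) (dv 0) (dvbar 0), laxCoeff l⁆ := by
  have h : ((PowerSeries.X : Series m) • (laxPi (m := m)).map (seriesDeriv Dx)).map
      (PowerSeries.coeff (l + 1)) =
      (laxL * laxPi - laxPi * laxL).map (PowerSeries.coeff (l + 1)) := by rw [lax_equation]
  have hX : ∀ M : Matrix (Unit ⊕ Fin m) (Unit ⊕ Fin m) (Series m),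
      ((PowerSeries.X : Series m) • M).map (PowerSeries.coeff (l + 1)) =
        M.map (PowerSeries.coeff l) := fun M => Matrix.ext fun p q => by
    rw [Matrix.map_apply, Matrix.smul_apply, smul_eq_mul, PowerSeries.coeff_succ_X_mul,
      Matrix.map_apply]
  have hD : ((laxPi (m := m)).map (seriesDeriv Dx)).map (PowerSeries.coeff l) =
      (laxCoeff l).map Dx := Matrix.ext fun p q => coeff_seriesDeriv Dx (laxPi p q) l
  rw [hX, hD, Matrix.map_sub _ (map_sub _), laxL, Matrix.add_mul, Matrix.mul_add, Matrix.smul_mul,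
    Matrix.mul_smul, Matrix.map_add _ (map_add _), Matrix.map_add _ (map_add _), hX, hX,
    map_coeff_C_mul, map_coeff_C_mul, map_coeff_mul_C, map_coeff_mul_C] at h
  rw [h, Ring.lie_def, Ring.lie_def, laxCoeff, laxCoeff]
  abel

lemma map_derivation_lie {n : Type*} [Fintype n] (d : Derivation ℂ (DiffPoly m) (DiffPoly m))
    (M N : Matrix n n (DiffPoly m)) : ⁅M, N⁆.map d = ⁅M.map d, N⁆ + ⁅M, N.map d⁆ := by
  rw [Ring.lie_def, Ring.lie_def, Ring.lie_def, map_derivation_sub, map_derivation_mul,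
    map_derivation_mul]
  abel

lemma map_derivation_complex_smul {n : Type*} (d : Derivation ℂ (DiffPoly m) (DiffPoly m)) (c : ℂ)
    (M : Matrix n n (DiffPoly m)) : (c • M).map d = c • M.map d :=
  Matrix.ext fun i j => d.map_smul c (M i j)

lemma map_derivation_finset_sum {n ι : Type*} (d : Derivation ℂ (DiffPoly m) (DiffPoly m))
    (s : Finset ι) (M : ι → Matrix n n (DiffPoly m)) :
    (∑ i ∈ s, M i).map d = ∑ i ∈ s, (M i).map d := by
  ext1 i j
  simp [Matrix.sum_apply]

/-- Reversing the order of summation swaps the two entries of each bracket, so the sum equals its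
own negative. -/
lemma sum_range_lie_reflect {n : Type*} [Fintype n] [DecidableEq n]
    (P : ℕ → Matrix n n (DiffPoly m)) (a k : ℕ) :
    ∑ j ∈ Finset.range k, ⁅P (a + j), P (a + (k - 1 - j))⁆ = 0 := by
  have h : ∑ j ∈ Finset.range k, ⁅P (a + j), P (a + (k - 1 - j))⁆ =
      -∑ j ∈ Finset.range k, ⁅P (a + j), P (a + (k - 1 - j))⁆ := by
    conv_lhs => rw [← Finset.sum_range_reflect]
    rw [← Finset.sum_neg_distrib]
    refine Finset.sum_congr rfl fun j hj => ?_
    have := Finset.mem_range.mp hj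
    rw [show k - 1 - (k - 1 - j) = j by omega, ← lie_skew]
  have h2 : (2 : ℂ) • ∑ j ∈ Finset.range k, ⁅P (a + j), P (a + (k - 1 - j))⁆ = 0 := by
    rw [two_smul]
    nth_rewrite 1 [h]
    exact neg_add_cancel _
  exact (smul_eq_zero.mp h2).resolve_left two_ne_zero

/-- The derivative of `laxCoeff l` along the `k`-th flow. -/
def laxFlow (k l : ℕ) : Matrix (Unit ⊕ Fin m) (Unit ⊕ Fin m) (DiffPoly m) :=
  Complex.I • ∑ j ∈ Finset.range (k + 1), ⁅laxCoeff (m := m) j, laxCoeff (l + k - j)⁆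

lemma laxJ_lie (M : Matrix (Unit ⊕ Fin m) (Unit ⊕ Fin m) (DiffPoly m)) :
    ⁅laxJ (m := m), M⁆ = fromBlocks 0 (of fun _ b => -(Complex.I • M (Sum.inl ()) (Sum.inr b)))
      (of fun a _ => Complex.I • M (Sum.inr a) (Sum.inl ())) 0 := by
  rw [Ring.lie_def]
  ext1 p q
  obtain u | a := p <;> obtain v | b := q <;>
    simp [laxJ, Matrix.mul_apply, MvPolynomial.smul_eq_C_mul, mul_comm]

lemma laxQ_evol (k : ℕ) :
    (laxQ (dv 0) (dvbar (m := m) 0)).map (evol (Complex.I • hvec k)) =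
      Complex.I • ⁅laxJ (m := m), laxCoeff (k + 1)⁆ := by
  have h1 := fun j => congrFun (vevol_dv (Complex.I • hvec (m := m) k)) j
  have h2 := fun j => congrFun (vevol_dvbar (Complex.I • hvec (m := m) k)) j
  simp only [vevol] at h1 h2
  rw [laxJ_lie]
  ext1 p q
  obtain u | a := p <;> obtain v | b := q <;>
    simp [laxQ, h1, h2, vconj, conj_smul, laxCoeff_succ_inl_inr, laxCoeff_succ_inr_inl, smul_smul]

/-- The candidate evolution satisfies the linearized Lax recursion. By the Jacobi identity the
excess telescopes in j, leaving [[J, P_{k+1}], P_l], which is the variation of Q by `laxQ_evol`. -/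
lemma map_Dx_laxFlow (k l : ℕ) :
    (laxFlow (m := m) k l).map Dx = ⁅laxJ (m := m), laxFlow k (l + 1)⁆ +
      ⁅laxQ (m := m) (dv 0) (dvbar 0), laxFlow k l⁆ +
      ⁅(laxQ (dv 0) (dvbar (m := m) 0)).map (evol (Complex.I • hvec k)), laxCoeff l⁆ := by
  have ht := Finset.sum_range_sub
    (fun j => ⁅⁅laxJ (m := m), laxCoeff (m := m) j⁆, laxCoeff (m := m) (l + 1 + k - j)⁆) (k + 1)
  have h0 : ⁅laxJ (m := m), laxCoeff (m := m) 0⁆ = 0 := by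
    rw [laxJ_lie, laxCoeff_zero]
    ext1 p q
    obtain u | a := p <;> obtain v | b := q <;> simp
  rw [h0, zero_lie, sub_zero, show l + 1 + k - (k + 1) = l by omega] at ht
  rw [laxQ_evol, smul_lie, ← ht, laxFlow, laxFlow, lie_smul, lie_smul, ← smul_add, ← smul_add,
    map_derivation_complex_smul, map_derivation_finset_sum, lie_sum, lie_sum,
    ← Finset.sum_add_distrib, ← Finset.sum_add_distrib]
  congr 1
  refine Finset.sum_congr rfl fun j hj => ?_
  have hj' := Finset.mem_range.mp hj
  have e1 : l + k - j + 1 = l + 1 + k - j := by omega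
  have e2 : l + 1 + k - (j + 1) = l + k - j := by omega
  rw [map_derivation_lie, map_Dx_laxCoeff, map_Dx_laxCoeff, e1, e2, leibniz_lie laxJ,
    leibniz_lie (laxQ _ _), add_lie, lie_add]
  abel

/-- The difference W_l of the two sides obeys the homogeneous recursion D_x W_l = [J, W_{l+1}] + [Q,
W_l] and W₀ = 0. If W_l = 0, then [J, W_{l+1}] = 0 kills the off-diagonal blocks of W_{l+1}. Its
diagonal blocks then have zero derivative by the next recursion step, and they have zero constant
term. -/
theorem map_evol_laxCoeff (k l : ℕ) :
    (laxCoeff (m := m) l).map (evol (Complex.I • hvec k)) = laxFlow k l := by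
  set δ := evol (Complex.I • hvec (m := m) k) with hδ
  set W : ℕ → Matrix (Unit ⊕ Fin m) (Unit ⊕ Fin m) (DiffPoly m) := fun l =>
    (laxCoeff l).map δ - laxFlow k l with hW
  have hrec : ∀ l, (W l).map Dx = ⁅laxJ (m := m), W (l + 1)⁆ + ⁅laxQ (m := m) (dv 0) (dvbar 0), W l⁆ := by
    intro l
    have h1 : ((laxCoeff (m := m) l).map δ).map Dx = ((laxCoeff l).map Dx).map δ :=
      Matrix.ext fun p q => (evol_Dx _ _).symm
    have hJ : (laxJ (m := m)).map δ = 0 := by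
      ext1 p q
      obtain u | a := p <;> obtain v | b := q <;> simp [laxJ]
    rw [hW]
    dsimp only
    rw [map_derivation_sub, h1, map_Dx_laxCoeff, map_derivation_add, map_derivation_lie,
      map_derivation_lie, hJ, map_Dx_laxFlow, zero_lie, lie_sub, lie_sub]
    abel
  have hcc : ∀ l p q, MvPolynomial.constantCoeff (W l p q) = 0 := by
    intro l p q
    have h1 : MvPolynomial.constantCoeff (δ (laxCoeff l p q)) = 0 := by
      refine constantCoeff_evol _ (fun j => ?_) _
      rw [Pi.smul_apply, MvPolynomial.constantCoeff_smul, constantCoeff_hvec, smul_zero]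
    have hm : ∀ i j : ℕ, ⁅(laxCoeff (m := m) i).map MvPolynomial.constantCoeff,
        (laxCoeff (m := m) j).map MvPolynomial.constantCoeff⁆ = 0 := by
      intro i j
      cases i with
      | succ i => rw [constantCoeff_laxCoeff_succ, zero_lie]
      | zero => cases j with
        | succ j => rw [constantCoeff_laxCoeff_succ, lie_zero]
        | zero => rw [lie_self]
    have h2 : ∀ i j : ℕ, MvPolynomial.constantCoeff (⁅laxCoeff (m := m) i, laxCoeff j⁆ p q) = 0 := by
      intro i j
      have := congrFun (congrFun (hm i j) p) q
      rw [Ring.lie_def, ← Matrix.map_mul, ← Matrix.map_mul] at this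
      rw [Ring.lie_def, Matrix.sub_apply, map_sub]
      exact this
    rw [hW]
    simp only [Matrix.sub_apply, Matrix.map_apply, map_sub, h1, laxFlow, Matrix.smul_apply,
      MvPolynomial.constantCoeff_smul, Matrix.sum_apply, map_sum, h2, Finset.sum_const_zero,
      smul_zero, sub_zero]
  have hzero : ∀ l, W l = 0 := by
    intro l
    induction l with
    | zero =>
      have h1 : (laxCoeff (m := m) 0).map δ = 0 := by
        rw [laxCoeff_zero]
        ext1 p q
        obtain u | a := p <;> obtain v | b := q <;> simp
      have h2 := sum_range_lie_reflect (laxCoeff (m := m)) 0 (k + 1)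
      simp only [zero_add, Nat.add_sub_cancel] at h2
      rw [hW]
      simp only [h1, laxFlow, zero_add, h2, smul_zero, sub_zero]
    | succ l ih =>
      have h1 := hrec l
      have hI : ∀ f : DiffPoly m, Complex.I • f = 0 → f = 0 := fun f hf =>
        (smul_eq_zero.mp hf).resolve_left Complex.I_ne_zero
      rw [ih, lie_zero, add_zero, laxJ_lie] at h1
      have h12 : ∀ b, W (l + 1) (Sum.inl ()) (Sum.inr b) = 0 := fun b => hI _ <| by
        have := congrFun (congrFun h1 (Sum.inl ())) (Sum.inr b)
        simpa using this.symm
      have h21 : ∀ a, W (l + 1) (Sum.inr a) (Sum.inl ()) = 0 := fun a => hI _ <| by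
        have := congrFun (congrFun h1 (Sum.inr a)) (Sum.inl ())
        simpa using this.symm
      have h2 := hrec (l + 1)
      rw [laxJ_lie] at h2
      ext1 p q
      obtain u | a := p <;> obtain v | b := q
      · refine eq_zero_of_Dx_eq_zero ?_ (hcc _ _ _)
        have := congrFun (congrFun h2 (Sum.inl ())) (Sum.inl ())
        rw [Matrix.map_apply] at this
        rw [this, Ring.lie_def]
        simp [Matrix.mul_apply, laxQ, h12, h21]
      · exact h12 b
      · exact h21 a
      · refine eq_zero_of_Dx_eq_zero ?_ (hcc _ _ _)
        have := congrFun (congrFun h2 (Sum.inr a)) (Sum.inr b)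
        rw [Matrix.map_apply] at this
        rw [this, Ring.lie_def]
        simp [Matrix.mul_apply, laxQ, h12, h21]
  exact sub_eq_zero.mp (hzero l)

/-- All brackets on both sides have total index k + l + 1. The longer sum has the extra range k < j
≤ l, which is symmetric under j ↦ k + l + 1 - j and cancels. -/
lemma laxFlow_symm {k l : ℕ} (h : k ≤ l) :
    laxFlow (m := m) k (l + 1) = laxFlow l (k + 1) := by
  obtain ⟨n, rfl⟩ := Nat.exists_eq_add_of_le h
  rw [laxFlow, laxFlow, show k + n + 1 = (k + 1) + n by omega, Finset.sum_range_add _ (k + 1) n,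
    show k + 1 + n + k = k + 1 + (k + n) by omega]
  have h2 := sum_range_lie_reflect (laxCoeff (m := m)) (k + 1) n
  rw [Finset.sum_congr rfl (g := fun j =>
    ⁅laxCoeff (m := m) (k + 1 + j), laxCoeff (k + 1 + (k + n) - (k + 1 + j))⁆)] at h2
  · rw [h2, add_zero]
  · intro j hj
    have := Finset.mem_range.mp hj
    rw [show k + 1 + (k + n) - (k + 1 + j) = k + 1 + (n - 1 - j) by omega]

theorem flowsCommute_hvec (k l : ℕ) :
    FlowsCommute (Complex.I • hvec (m := m) k) (Complex.I • hvec l) := by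
  have key : ∀ k l : ℕ, k ≤ l →
      FlowsCommute (Complex.I • hvec (m := m) k) (Complex.I • hvec l) := by
    intro k l h
    ext1 j
    have h1 := congrFun (congrFun (map_evol_laxCoeff (m := m) k (l + 1)) (Sum.inl ())) (Sum.inr j)
    have h2 := congrFun (congrFun (map_evol_laxCoeff (m := m) l (k + 1)) (Sum.inl ())) (Sum.inr j)
    rw [← laxFlow_symm h, ← h1, Matrix.map_apply, Matrix.map_apply, laxCoeff_succ_inl_inr,
      laxCoeff_succ_inl_inr, map_neg, map_neg, neg_inj] at h2
    exact h2.symm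
  rcases le_total k l with h | h
  · exact key k l h
  · exact (key l k h).symm

end

/-! ### The recursion operator and the bi-Hamiltonian form -/

/-- A converse to `HValue.exists_potential`: any potential with constant terms C yields the scalar
primitive as (i/2) tr Θ. -/
lemma HValue.of_potential {C : Matrix (Fin m) (Fin m) ℂ} {ω : DVec m}
    {Θ : Matrix (Fin m) (Fin m) (DiffPoly m)} (hΘ : Θ.map Dx = hwedge (dvbar 0) ω)
    (hC : ∀ a b, MvPolynomial.constantCoeff (Θ a b) = C a b) :
    HValue C ω (vDx ω + dv 0 ᵥ* addTrace Θ) := by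
  refine ⟨(Complex.I / 2) • Θ.trace, Θ, ⟨?_, ?_⟩,
    fun a b => ⟨congrFun (congrFun hΘ a) b, hC a b⟩, ?_⟩
  · rw [Derivation.map_smul, derivation_trace, hΘ, hdot_dvbar]
  · rw [MvPolynomial.constantCoeff_smul, Matrix.trace, Matrix.trace, map_sum, smul_eq_mul]
    congr 1
    exact Finset.sum_congr rfl fun a _ => hC a a
  · have hI : (2 * Complex.I) * (Complex.I / 2) = -1 := by linear_combination Complex.I_mul_I
    rw [addTrace, Matrix.vecMul_add, Matrix.vecMul_smul, Matrix.vecMul_one, ← smul_assoc,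
      smul_smul, hI, neg_one_smul]
    module

lemma HValue.unique {C : Matrix (Fin m) (Fin m) ℂ} {ω X Y : DVec m} (hX : HValue C ω X)
    (hY : HValue C ω Y) : X = Y := by
  obtain ⟨s, Θ, hs, hΘ, rfl⟩ := hX
  obtain ⟨s', Θ', hs', hΘ', rfl⟩ := hY
  have h1 : s = s' := eq_of_Dx_eq (hs.1.trans hs'.1.symm) (hs.2.trans hs'.2.symm)
  have h2 : Θ = Θ' := Matrix.ext fun a b =>
    eq_of_Dx_eq ((hΘ a b).1.trans (hΘ' a b).1.symm) ((hΘ a b).2.trans (hΘ' a b).2.symm)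
  rw [h1, h2]

lemma hwedge_sub (A B C : DVec m) : hwedge A (B - C) = hwedge A B - hwedge A C := by
  have h : vconj (B - C) = vconj B - vconj C := by rw [sub_eq_add_neg, vconj_add, vconj_neg,
    ← sub_eq_add_neg]
  ext1 a b
  simp only [hwedge, h, Matrix.sub_apply, vecMulVec_apply, Pi.sub_apply]
  ring

lemma hwedge_real_smul (r : ℝ) (A B : DVec m) :
    hwedge A ((r : ℂ) • B) = (r : ℂ) • hwedge A B := by
  rw [hwedge, hwedge, vconj_smul, Complex.star_def, Complex.conj_ofReal, vecMulVec_smul,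
    smul_vecMulVec, smul_sub]

lemma hwedge_neg (A B : DVec m) : hwedge A (-B) = -hwedge A B := by
  rw [hwedge, hwedge, vconj_neg, vecMulVec_neg, neg_vecMulVec]
  abel

lemma I_smul_I_smul (A : DVec m) : Complex.I • (Complex.I • A) = -A := by
  rw [smul_smul, Complex.I_mul_I, neg_one_smul]

lemma addTrace_neg (M : Matrix (Fin m) (Fin m) (DiffPoly m)) : addTrace (-M) = -addTrace M := by
  rw [addTrace, addTrace, trace_neg, neg_smul]
  abel

lemma addTrace_sub (M N : Matrix (Fin m) (Fin m) (DiffPoly m)) :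
    addTrace (M - N) = addTrace M - addTrace N := by
  rw [addTrace, addTrace, addTrace, trace_sub, sub_smul]
  abel

lemma addTrace_smul (c : ℂ) (M : Matrix (Fin m) (Fin m) (DiffPoly m)) :
    addTrace (c • M) = c • addTrace M := by
  rw [addTrace, addTrace, trace_smul, smul_add, smul_assoc]

lemma vDx_neg (A : DVec m) : vDx (-A) = -vDx A := by
  ext1 j; simp [vDx]

lemma vDx_sub (A B : DVec m) : vDx (A - B) = vDx A - vDx B := by
  ext1 j; simp [vDx]

lemma vDx_smul (c : ℂ) (A : DVec m) : vDx (c • A) = c • vDx A := by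
  ext1 j; simp [vDx]

lemma vDx_mul (f : DiffPoly m) (A : DVec m) : vDx (f • A) = Dx f • A + f • vDx A := by
  ext1 j; exact Dx_mul f (A j)

lemma vDx_add_vecMul_hvec (k : ℕ) :
    vDx (hvec k) + dv 0 ᵥ* addTrace (pot (m := m) k) = -(Complex.I • hvec (k + 1)) := by
  rw [hvec_succ, I_smul_I_smul, neg_neg]

lemma hvalue_neg_hvec (k : ℕ) : HValue 0 (-hvec (m := m) k) (Complex.I • hvec (k + 1)) := by
  have h := HValue.of_potential (C := 0) (ω := -hvec k) (Θ := -pot (m := m) k)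
    (by rw [hwedge_neg, ← Dx_pot]; exact Matrix.ext fun a b => map_neg Dx _)
    (fun a b => by simp [constantCoeff_pot])
  rwa [vDx_neg, addTrace_neg, vecMul_neg, ← neg_add, vDx_add_vecMul_hvec, neg_neg] at h

lemma isHierarchy_hvec : IsHierarchy (hvec (m := m)) := by
  refine ⟨by rw [hvec_zero], fun k => ?_⟩
  rw [RValue, I_smul_I_smul]
  exact hvalue_neg_hvec k

lemma IsHierarchy.eq_hvec {h : ℕ → DVec m} (hh : IsHierarchy h) : h = hvec := by
  have hI : Function.Injective fun A : DVec m => Complex.I • A :=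
    smul_right_injective _ Complex.I_ne_zero
  funext k
  induction k with
  | zero => rw [hvec_zero]; exact hI hh.1
  | succ k ih =>
    apply hI
    have h1 := hh.2 k
    rw [RValue, I_smul_I_smul, ih] at h1
    exact h1.unique (hvalue_neg_hvec k)

lemma varDeriv_hamChi_succ_succ (χ : ℝ) (j : ℕ) :
    varDeriv (hamChi (ham (m := m)) χ (j + 2)) = -(hvec (j + 2) - (χ : ℂ) • hvec j) := by
  rw [hamChi, varDeriv_sub, varDeriv_smul, varDeriv_ham, varDeriv_ham]
  module

lemma conjTranspose_intConst (χ : ℝ) (k : ℕ) :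
    (intConst m χ k)ᴴ = -intConst m χ k := by
  cases k with
  | succ k => simp [intConst]
  | zero =>
    rw [intConst, conjTranspose_smul, conjTranspose_one, ← neg_smul]
    congr 1
    simp [neg_div]

lemma hvalue_flow (χ : ℝ) (k : ℕ) :
    HValue (intConst m χ k) (varDeriv (hamChi ham χ (k + 1))) (flow hvec χ k) := by
  cases k with
  | succ k =>
    rw [varDeriv_hamChi_succ_succ, intConst]
    have h := HValue.of_potential (C := 0) (ω := -(hvec (k + 2) - (χ : ℂ) • hvec k))
      (Θ := -(pot (m := m) (k + 2) - (χ : ℂ) • pot k))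
      (by
        rw [hwedge_neg, hwedge_sub, hwedge_real_smul, ← Dx_pot, ← Dx_pot]
        exact Matrix.ext fun a b => by simp)
      (fun a b => by simp [constantCoeff_pot, MvPolynomial.constantCoeff_smul])
    convert h using 1
    have h1 := vDx_add_vecMul_hvec (m := m) (k + 2)
    have h2 := vDx_add_vecMul_hvec (m := m) k
    rw [vDx_neg, addTrace_neg, vecMul_neg, vDx_sub, addTrace_sub, vecMul_sub, vDx_smul,
      addTrace_smul, vecMul_smul, flow]
    rw [← eq_sub_iff_add_eq'] at h1 h2
    rw [h1, h2, show k + 1 + 2 = k + 2 + 1 from rfl]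
    module
  | zero =>
    rw [zero_add, hamChi, varDeriv_ham, intConst]
    set c : ℂ := -(Complex.I * χ / ((m : ℂ) + 1)) with hc
    have hm : (m : ℂ) + 1 ≠ 0 := Nat.cast_add_one_ne_zero m
    -- The constant matrix c·1 is added to the potential of -h⁽¹⁾. Since `addTrace 1` is (m+1)·1, it
    -- contributes (m+1)c v = -χ i v, the term that no covector supplies for k = 0.
    have h := HValue.of_potential (C := c • 1) (ω := -hvec 1) (Θ := -pot (m := m) 1 + c • 1)
      (by
        rw [hwedge_neg, ← Dx_pot]
        refine Matrix.ext fun a b => ?_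
        simp only [Matrix.map_apply, Matrix.add_apply, Matrix.smul_apply, Matrix.neg_apply, map_add,
          map_neg, Matrix.one_apply, Derivation.map_smul]
        split_ifs <;> simp)
      (fun a b => by
        simp only [Matrix.add_apply, Matrix.smul_apply, Matrix.neg_apply, map_add, map_neg,
          constantCoeff_pot, MvPolynomial.constantCoeff_smul, Matrix.one_apply]
        split_ifs <;> simp)
    convert h using 1
    have h1 := vDx_add_vecMul_hvec (m := m) 1
    have h2 : dv 0 ᵥ* addTrace (-pot (m := m) 1 + c • 1) =
        -(dv 0 ᵥ* addTrace (pot 1)) + ((m + 1) * c) • dv 0 := by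
      have h3 : addTrace (1 : Matrix (Fin m) (Fin m) (DiffPoly m)) = ((m : ℂ) + 1) • 1 := by
        rw [addTrace, trace_one, Fintype.card_fin, Nat.cast_smul_eq_nsmul,
          ← Nat.cast_smul_eq_nsmul ℂ]
        module
      rw [← sub_neg_eq_add (-pot 1), addTrace_sub, addTrace_neg, vecMul_sub, vecMul_neg, ← neg_smul,
        addTrace_smul, h3, vecMul_smul, vecMul_smul, vecMul_one]
      module
    have h3 : ((m : ℂ) + 1) * c = -(Complex.I * χ) := by
      rw [hc]; field_simp
    rw [vDx_neg, h2, h3, flow, hvec_zero]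
    rw [← eq_sub_iff_add_eq'] at h1
    rw [h1, show 0 + 2 = 1 + 1 from rfl]
    module

lemma flow_eq_neg_I_smul (χ : ℝ) (k : ℕ) :
    flow (hvec (m := m)) χ k = -(Complex.I • varDeriv (hamChi ham χ (k + 2))) := by
  rw [varDeriv_hamChi_succ_succ, flow, smul_neg, neg_neg]

/-- `evol` is only real linear in the vector field because v̄ evolves by the conjugate; this is
where the reality of χ enters. -/
lemma evol_sub_real_smul (X Y : DVec m) (r : ℝ) (f : DiffPoly m) :
    evol (X - (r : ℂ) • Y) f = evol X f - (r : ℂ) • evol Y f := by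
  have hsub : ∀ (n : ℕ) (f g : DiffPoly m),
      Dx^[n] (f - (r : ℂ) • g) = Dx^[n] f - (r : ℂ) • Dx^[n] g := by
    intro n f g
    induction n with
    | zero => rfl
    | succ n ih => simp only [Function.iterate_succ_apply', ih, map_sub, Derivation.map_smul]
  have h : evol (X - (r : ℂ) • Y) = evol X - (r : ℂ) • evol Y := by
    apply MvPolynomial.derivation_ext
    rintro ⟨b, j, n⟩
    rw [Derivation.sub_apply, Derivation.smul_apply, evol_eq_prolong, evol_eq_prolong,
      evol_eq_prolong, prolong_X, prolong_X, prolong_X, ← hsub]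
    cases b
    · simp
    · simp only [if_true, Pi.sub_apply, Pi.smul_apply, map_sub, conj_smul, Complex.star_def,
        Complex.conj_ofReal]
  rw [h, Derivation.sub_apply, Derivation.smul_apply]

lemma flowsCommute_flow (χ : ℝ) (k l : ℕ) :
    FlowsCommute (flow (hvec (m := m)) χ k) (flow hvec χ l) := by
  have hf : ∀ k, flow (hvec (m := m)) χ k =
      Complex.I • hvec (k + 2) - (χ : ℂ) • (Complex.I • hvec k) := by
    intro k
    rw [flow]
    module
  have c := fun k l => fun j => congrFun (flowsCommute_hvec (m := m) k l) j
  simp only [vevol] at c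
  ext1 j
  rw [hf, hf]
  simp only [vevol, evol_sub_real_smul, Pi.sub_apply, Pi.smul_apply (χ : ℂ), map_sub,
    Derivation.map_smul _ (χ : ℂ), c k l j, c (k + 2) (l + 2) j, c k (l + 2) j, c (k + 2) l j]
  module

/-! ### Unitary invariance -/

/-- A constant matrix as a matrix of differential polynomials. -/
def constMat (A : Matrix (Fin m) (Fin m) ℂ) : Matrix (Fin m) (Fin m) (DiffPoly m) :=
  A.map fun c => MvPolynomial.C c

lemma constMat_mul (A B : Matrix (Fin m) (Fin m) ℂ) :
    constMat (A * B) = constMat A * constMat B := by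
  ext1 a b
  simp [constMat, Matrix.mul_apply]

lemma constMat_one : constMat (1 : Matrix (Fin m) (Fin m) ℂ) = 1 := by
  ext1 a b
  simp only [constMat, Matrix.map_apply, Matrix.one_apply]
  split_ifs <;> simp

lemma actRight_eq (A : Matrix (Fin m) (Fin m) ℂ) (w : DVec m) :
    actRight A w = w ᵥ* constMat A := rfl

lemma vDx_vecMul_constMat (w : DVec m) (A : Matrix (Fin m) (Fin m) ℂ) :
    vDx (w ᵥ* constMat A) = vDx w ᵥ* constMat A := by
  have h : (constMat A).map Dx = 0 := Matrix.ext fun a b => by simp [constMat]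
  rw [vDx_vecMul, h, vecMul_zero, add_zero]

lemma vconj_vecMul_constMat (w : DVec m) (A : Matrix (Fin m) (Fin m) ℂ) :
    vconj (w ᵥ* constMat A) = vconj w ᵥ* constMat (A.map star) := by
  ext1 b
  simp [vconj, Matrix.vecMul, dotProduct, constMat, conj_C]

lemma unitarySubst_X (A : Matrix (Fin m) (Fin m) ℂ) (p : JetVar m) :
    unitarySubst A (MvPolynomial.X p) =
      if p.1 then actRight (A.map star) (dvbar p.2.2) p.2.1 else actRight A (dv p.2.2) p.2.1 := by
  simp [unitarySubst]

lemma unitarySubst_dv (A : Matrix (Fin m) (Fin m) ℂ) (j : Fin m) :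
    unitarySubst A (dv 0 j) = (dv 0 ᵥ* constMat A) j := by
  rw [dv, unitarySubst_X, ← actRight_eq]; simp

lemma unitarySubst_Dx (A : Matrix (Fin m) (Fin m) ℂ) (f : DiffPoly m) :
    unitarySubst A (Dx f) = Dx (unitarySubst A f) := by
  induction f using MvPolynomial.induction_on with
  | C a => simp [unitarySubst]
  | add p q hp hq => simp only [map_add, hp, hq]
  | mul_X p i hp =>
    obtain ⟨b, j, n⟩ := i
    have h1 := congrFun (vDx_vecMul_constMat (dv n) A) j
    have h2 := congrFun (vDx_vecMul_constMat (dvbar n) (A.map star)) j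
    rw [Dx_mul, map_add, map_mul, map_mul, hp, map_mul, Dx_mul, Dx_X, unitarySubst_X,
      unitarySubst_X]
    congr 2
    cases b
    · simpa [actRight_eq, vDx] using h1.symm
    · simpa [actRight_eq, vDx] using h2.symm

lemma unitarySubst_conj (A : Matrix (Fin m) (Fin m) ℂ) (f : DiffPoly m) :
    unitarySubst A (conj f) = conj (unitarySubst A f) := by
  induction f using MvPolynomial.induction_on with
  | C a => simp [unitarySubst, conj_C]
  | add p q hp hq => simp only [map_add, hp, hq]
  | mul_X p i hp =>
    obtain ⟨b, j, n⟩ := i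
    have h1 := congrFun (vconj_vecMul_constMat (dv n) A) j
    have h2 := congrFun (vconj_vecMul_constMat (dvbar n) (A.map star)) j
    rw [map_mul, map_mul, hp, map_mul, map_mul, conj_X, unitarySubst_X, unitarySubst_X]
    congr 1
    cases b
    · simpa [actRight_eq, vconj] using h1.symm
    · have h3 : (A.map star).map star = A := Matrix.ext fun a b => star_star _
      rw [h3] at h2
      simpa [actRight_eq, vconj] using h2.symm

lemma vecMulVec_vecMul_vecMul (u w : DVec m) (B M : Matrix (Fin m) (Fin m) (DiffPoly m)) :
    vecMulVec (u ᵥ* B) (w ᵥ* M) = Bᵀ * vecMulVec u w * M := by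
  rw [Matrix.mul_vecMulVec, Matrix.vecMulVec_mul, Matrix.mulVec_transpose]

lemma pot_succ_eq (k : ℕ) : pot (m := m) (k + 1) =
    Complex.I • ∑ p ∈ Finset.HasAntidiagonal.antidiagonal k,
      (vecMulVec (vconj (hvec (m := m) p.1)) (hvec p.2) -
        (pot (m := m) p.1).trace • pot (m := m) p.2) := by
  ext1 a b
  rw [pot_succ, Matrix.smul_apply, Matrix.sum_apply]
  rfl

/-- Equivariance must be proved jointly: h⁽ᵏ⁾ is multiplied by A while its potential is conjugated
by A. Traces are then invariant, and both recursions are preserved because A is unitary. -/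
lemma unitarySubst_hierarchy {A : Matrix (Fin m) (Fin m) ℂ} (hA : A ∈ unitaryGroup (Fin m) ℂ)
    (k : ℕ) : (∀ j, unitarySubst A (hvec k j) = (hvec k ᵥ* constMat A) j) ∧
      (pot k).map (unitarySubst A) = constMat Aᴴ * pot k * constMat A := by
  have hA1 : constMat A * constMat Aᴴ = 1 := by
    rw [← constMat_mul, ← star_eq_conjTranspose, mem_unitaryGroup_iff.mp hA, constMat_one]
  have hA2 : constMat Aᴴ * constMat A = 1 := by
    rw [← constMat_mul, ← star_eq_conjTranspose, mem_unitaryGroup_iff'.mp hA, constMat_one]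
  have htr : ∀ M : Matrix (Fin m) (Fin m) (DiffPoly m),
      (constMat Aᴴ * M * constMat A).trace = M.trace := by
    intro M
    rw [Matrix.trace_mul_cycle, hA1, Matrix.one_mul]
  induction k using Nat.strong_induction_on with
  | _ k ih =>
    cases k with
    | zero =>
      refine ⟨fun j => by rw [hvec_zero, unitarySubst_dv], ?_⟩
      rw [pot_zero, Matrix.mul_zero, Matrix.zero_mul]
      exact Matrix.ext fun a b => map_zero (unitarySubst A)
    | succ k =>
      constructor
      · intro j
        obtain ⟨i1, i2⟩ := ih k (Nat.lt_succ_self k)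
        have e1 : unitarySubst A (vDx (hvec k) j) = (vDx (hvec k) ᵥ* constMat A) j := by
          rw [vDx, unitarySubst_Dx, i1, ← vDx_vecMul_constMat]
          rfl
        have e2 : (addTrace (pot k)).map (unitarySubst A) =
            constMat Aᴴ * addTrace (pot k) * constMat A := by
          have : (addTrace (pot k)).map (unitarySubst A) =
              addTrace ((pot k).map (unitarySubst A)) := by
            ext1 a b
            simp only [addTrace, Matrix.map_apply, Matrix.add_apply, Matrix.smul_apply, map_add,
              smul_eq_mul, map_mul, Matrix.one_apply, Matrix.trace, Matrix.diag, map_sum]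
            split_ifs <;> simp
          rw [this, i2, addTrace, addTrace, htr, Matrix.mul_add, Matrix.add_mul, Matrix.mul_smul,
            Matrix.smul_mul, Matrix.mul_one, hA2]
        have e3 : unitarySubst A ((dv 0 ᵥ* addTrace (pot k)) j) =
            ((dv 0 ᵥ* addTrace (pot k)) ᵥ* constMat A) j := by
          have : unitarySubst A ((dv 0 ᵥ* addTrace (pot k)) j) =
              ((dv 0 ᵥ* constMat A) ᵥ* (addTrace (pot k)).map (unitarySubst A)) j := by
            simp only [Matrix.vecMul, dotProduct, map_sum, map_mul, Matrix.map_apply]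
            exact Finset.sum_congr rfl fun a _ => by rw [unitarySubst_dv]; rfl
          rw [this, e2, vecMul_vecMul, ← Matrix.mul_assoc, ← Matrix.mul_assoc, hA1, Matrix.one_mul,
            vecMul_vecMul]
        rw [hvec_succ, Pi.smul_apply, Pi.add_apply, map_smul, map_add, e1, e3, smul_vecMul,
          add_vecMul]
        rfl
      · have hv : ∀ (w : DVec m) (w' : DVec m), (∀ j, unitarySubst A (w j) = w' j) →
            ∀ j, unitarySubst A (vconj w j) = vconj w' j := fun w w' h j => by
          rw [vconj, unitarySubst_conj, h]; rfl
        have e : (pot (m := m) (k + 1)).map (unitarySubst A) =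
            Complex.I • ∑ p ∈ Finset.HasAntidiagonal.antidiagonal k,
              (vecMulVec (vconj (hvec p.1 ᵥ* constMat A)) (hvec p.2 ᵥ* constMat A) -
                ((pot p.1).map (unitarySubst A)).trace • (pot p.2).map (unitarySubst A)) := by
          ext1 a b
          rw [pot_succ_eq, Matrix.map_apply, Matrix.smul_apply, Matrix.sum_apply, map_smul, map_sum,
            Matrix.smul_apply, Matrix.sum_apply]
          congr 1
          refine Finset.sum_congr rfl fun p hp => ?_
          have hp' := Finset.HasAntidiagonal.mem_antidiagonal.mp hp
          simp only [Matrix.sub_apply, vecMulVec_apply, Matrix.smul_apply, smul_eq_mul, map_sub,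
            map_mul, hv _ _ (ih p.1 (by omega)).1, (ih p.2 (by omega)).1, Matrix.trace, map_sum,
            Matrix.diag, Matrix.map_apply]
        have hT : (constMat (A.map star))ᵀ = constMat Aᴴ := rfl
        rw [e, pot_succ_eq, Matrix.mul_smul, Matrix.smul_mul, Matrix.mul_sum, Matrix.sum_mul]
        congr 1
        refine Finset.sum_congr rfl fun p hp => ?_
        have hp' := Finset.HasAntidiagonal.mem_antidiagonal.mp hp
        rw [(ih p.1 (by omega)).2, (ih p.2 (by omega)).2, htr, vconj_vecMul_constMat,
          vecMulVec_vecMul_vecMul, hT, Matrix.mul_sub, Matrix.sub_mul, Matrix.mul_smul,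
          Matrix.smul_mul]

lemma isUnitaryInvariant_flow (χ : ℝ) (k : ℕ) : IsUnitaryInvariant (flow (hvec (m := m)) χ k) := by
  intro A hA
  ext1 j
  rw [actRight_eq, flow, smul_vecMul, sub_vecMul, smul_vecMul]
  simp only [Pi.smul_apply, Pi.sub_apply, map_smul, map_sub, (unitarySubst_hierarchy hA _).1]

/-! ### The first flows -/

lemma vecMul_vecMulVec_eq (u w z : DVec m) : u ᵥ* vecMulVec w z = (u ⬝ᵥ w) • z := by
  rw [vecMul_vecMulVec]

lemma hvec_two : hvec (m := m) 2 = -dv 2 - (2 : ℂ) • ((dv (m := m) 0 ⬝ᵥ dvbar 0) • dv 0) := by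
  rw [hvec_succ, hvec_one, pot_one, vDx_smul, vDx_dv, addTrace_smul, vecMul_smul, ← smul_add,
    I_smul_I_smul, addTrace, vecMul_add, vecMul_smul, vecMul_one, trace_vecMulVec,
    vecMul_vecMulVec_eq, dotProduct_comm (dvbar 0), two_smul]
  module

lemma hvec_three : hvec (m := m) 3 = -(Complex.I • (dv 3 +
    (3 : ℂ) • ((dv (m := m) 0 ⬝ᵥ dvbar 0) • dv 1) +
    (3 : ℂ) • ((dv (m := m) 1 ⬝ᵥ dvbar 0) • dv 0))) := by
  have h := hvec_succ (m := m) 2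
  rw [hvec_two, pot_two, vDx_sub, vDx_neg, vDx_smul, vDx_mul, Dx_dotProduct, vDx_dv, vDx_dv,
    vDx_dvbar, addTrace_sub, addTrace, addTrace, vecMul_sub, vecMul_add, vecMul_add, vecMul_smul,
    vecMul_smul, vecMul_one, trace_vecMulVec, trace_vecMulVec, vecMul_vecMulVec_eq,
    vecMul_vecMulVec_eq, dotProduct_comm (dvbar 0), dotProduct_comm (dvbar 1)] at h
  rw [h, ← smul_neg]
  congr 1
  have h3 : ∀ x : DVec m, (3 : ℂ) • x = x + x + x := fun x => by module
  simp only [zero_add, Nat.reduceAdd, add_smul, h3, two_smul]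
  module

lemma flow_zero (χ : ℝ) : Complex.I • flow (hvec (m := m)) χ 0 =
    dv 2 + (2 : ℂ) • ((dv (m := m) 0 ⬝ᵥ dvbar 0) • dv 0) + (χ : ℂ) • dv 0 := by
  rw [flow, I_smul_I_smul, zero_add, hvec_two, hvec_zero]
  module

lemma flow_one (χ : ℝ) : flow (hvec (m := m)) χ 1 =
    dv 3 + (3 : ℂ) • ((dv (m := m) 0 ⬝ᵥ dvbar 0) • dv 1) +
      (3 : ℂ) • ((dv (m := m) 1 ⬝ᵥ dvbar 0) • dv 0) + (χ : ℂ) • dv 1 := by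
  rw [flow, show 1 + 2 = 3 from rfl, hvec_three, hvec_one, smul_sub, smul_neg, I_smul_I_smul, smul_comm Complex.I (χ : ℂ),
    I_smul_I_smul]
  module

end VectorNLS

end

theorem corollary1 (N : ℕ) (hN : 2 ≤ N) :
    IsHamiltonianPair (m := N - 1) HGraph IGraph ∧
    ∃ h : ℕ → DVec (N - 1),
      IsHierarchy h ∧ (∀ h', IsHierarchy h' → h' = h) ∧
      (∀ k l, FlowsCommute (Complex.I • h k) (Complex.I • h l)) ∧
      ∃ Ham : ℕ → DiffPoly (N - 1),
        (∀ k, conj (Ham k) = Ham k) ∧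
        Ham 0 = -(dv 0 ⬝ᵥ dvbar 0) ∧
        Ham 1 = (Complex.I / 2) • (dv 0 ⬝ᵥ dvbar 1 - dv 1 ⬝ᵥ dvbar 0) ∧
        (∀ k, varDeriv (Ham k) = -h k) ∧
        ∀ χ : ℝ,
          (∀ k, (intConst (N - 1) χ k)ᴴ = -intConst (N - 1) χ k ∧
            HValue (intConst (N - 1) χ k) (varDeriv (hamChi Ham χ (k + 1))) (flow h χ k) ∧
            flow h χ k = -(Complex.I • varDeriv (hamChi Ham χ (k + 2)))) ∧
          (∀ k l, FlowsCommute (flow h χ k) (flow h χ l)) ∧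
          (∀ k, IsUnitaryInvariant (flow h χ k)) ∧
          Complex.I • flow h χ 0 =
            dv 2 + (2 : ℂ) • ((dv (m := N - 1) 0 ⬝ᵥ dvbar 0) • dv 0) + (χ : ℂ) • dv 0 ∧
          flow h χ 1 =
            dv 3 + (3 : ℂ) • ((dv (m := N - 1) 0 ⬝ᵥ dvbar 0) • dv 1) +
              (3 : ℂ) • ((dv (m := N - 1) 1 ⬝ᵥ dvbar 0) • dv 0) + (χ : ℂ) • dv 1 := by
  refine ⟨isHamiltonianPair_HGraph_IGraph, hvec, isHierarchy_hvec, fun h' hh => hh.eq_hvec,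
    flowsCommute_hvec, ham, conj_ham, ham_zero, ham_one, varDeriv_ham, fun χ =>
    ⟨fun k => ⟨conjTranspose_intConst χ k, hvalue_flow χ k, flow_eq_neg_I_smul χ k⟩,
      flowsCommute_flow χ, isUnitaryInvariant_flow χ, flow_zero χ, flow_one χ⟩⟩
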